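/- Let $(M,g)$ be an oriented space-time: a smooth oriented four-manifold with a smooth metric $g$ of signature $(-,+,+,+)$ and metric volume element $\eta$. For two-tensors write $(P\cdot Q)^\alpha{}_\beta=P^\alpha{}_\mu Q^\mu{}_\beta$ and $[P,Q]=P\cdot Q-Q\cdot P$; for a two-form $F$ write $(F,F)=\frac12F_{\alpha\beta}F^{\alpha\beta}$, $(*F)_{\alpha\beta}=\frac12\eta_{\alpha\beta\mu\nu}F^{\mu\nu}$ and $(\delta F)_\beta=-\nabla_\alpha F^\alpha{}_\beta$. Let $\mathcal A$ be a conformal Killing–Yano tensor in self-dual form, i.e. a smooth complex two-form with $*\mathcal A=\mathrm i\,\mathcal A$ and $$3\,\nabla_\gamma\mathcal A_{\alpha\beta}=2\,\mathcal Z^\delta\,\mathcal G_{\delta\gamma\alpha\beta},\qquad \mathcal Z=\delta\mathcal A,\qquad \mathcal G_{\alpha\beta\gamma\delta}=\tfrac12\left(g_{\alpha\gamma}g_{\beta\delta}-g_{\alpha\delta}g_{\beta\gamma}-\mathrm i\,\eta_{\alpha\beta\gamma\delta}\right).$$ (1) $\mathcal Z$ is a complex Killing vector or vanishes (i.e. $\mathcal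 L_{\mathcal Z}g=0$ on $M$) if and only if $[\mathcal A,Ric]=0$ on $M$. (2) At every point where $\mathcal A$ is non-null, $(\mathcal A,\mathcal A)\neq0$, one has $[\mathcal A,Ric]=0$ if and only if the Ricci tensor is of Segrè type $[(11)(11)]$ or $[(1111)]$ and is aligned with $\mathcal A$, the latter meaning that $Ric=-\kappa\,\Pi+\Lambda\,g$ for some real $\kappa,\Lambda$, where $\Pi=2\,|(\mathcal A,\mathcal A)|^{-1}\,\mathcal A\cdot\bar{\mathcal A}$ is the $2+2$ structure tensor of $\mathcal A$. (3) At every point where $\mathcal A$ is null, $\mathcal A\neq0$ and $(\mathcal A,\mathcal A)=0$, one has $[\mathcal A,Ric]=0$ if and only if the Ricci tensor is of Segrè type $[(211)]$ or $[(1111)]$ and is aligned with $\mathcal A$, the latter meaning that $Ric=\sigma\,\ell\otimes\ell+\Lambda\,g$ for some real $\sigma,\Lambda$ and some nonzero real null vector $\ell$ with $\mathcal A(\ell)=0$. Here the Segrè type is that of the endomorphism $Ric^\alpha{}_\beta$: $[(11)(11)]$ means two distinct real eigenvalues, each with a two-dimensional eigenspace; $[(1111)]$ a multiple of the identity; $[(211)]$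 a single real eigenvalue with Jordan blocks of sizes $2,1,1$. -/

import Mathlib

open scoped Manifold ContDiff Matrix

noncomputable section

/-! ## Tensor calculus in a coordinate domain of `ℝ⁴`

A tensor field is given here by its component functions; `g`, `η` are the components of the metric
and of the volume element, `A` those of a complex two-form (indices down), `y` is the point. -/

namespace CoordCalc

/-- The coordinate space `ℝ⁴`. -/
abbrev E4 : Type := EuclideanSpace ℝ (Fin 4)

/-- Partial derivative `∂ₖ f` at `y`. -/
def pd {F : Type} [NormedAddCommGroup F] [NormedSpace ℝ F] (k : Fin 4) (f : E4 → F) (y : E4) : F :=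
  fderiv ℝ f y (EuclideanSpace.single k 1)

variable (g : E4 → Matrix (Fin 4) (Fin 4) ℝ) (η : E4 → Fin 4 → Fin 4 → Fin 4 → Fin 4 → ℝ)
  (A : E4 → Matrix (Fin 4) (Fin 4) ℂ) (y : E4)

/-- Christoffel symbols of the Levi-Civita connection, `Γᵏᵢⱼ`. -/
def christoffel (y : E4) (k i j : Fin 4) : ℝ :=
  (1 / 2) * ∑ l, (g y)⁻¹ k l *
    (pd i (fun x => g x j l) y + pd j (fun x => g x i l) y - pd l (fun x => g x i j) y)

/-- Riemann tensor `Rᵃ_{bcd}`. -/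
def riemann (a b c d : Fin 4) : ℝ :=
  pd c (fun x => christoffel g x a b d) y - pd d (fun x => christoffel g x a b c) y
    + ∑ e, (christoffel g y a c e * christoffel g y e b d
      - christoffel g y a d e * christoffel g y e b c)

/-- Ricci tensor `R_{bd} = Rᵃ_{bad}`. -/
def ricci : Matrix (Fin 4) (Fin 4) ℝ :=
  Matrix.of fun b d => ∑ a, riemann g y a b a d

/-- The Ricci tensor as an endomorphism, `Rᵃ_b = gᵃᶜ R_{cb}`. -/
def ricciEnd : Matrix (Fin 4) (Fin 4) ℝ := (g y)⁻¹ * ricci g y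

/-- Covariant derivative of the two-form, `∇ₖ A_{ij}`. -/
def covDeriv (y : E4) (k i j : Fin 4) : ℂ :=
  pd k (fun x => A x i j) y
    - ∑ l, ((christoffel g y l k i : ℂ) * A y l j + (christoffel g y l k j : ℂ) * A y i l)

/-- Codifferential of the two-form, `(δA)_j = -∇_i Aⁱ_j`. -/
def codiff (y : E4) (j : Fin 4) : ℂ :=
  -∑ i, ∑ k, (((g y)⁻¹ i k : ℝ) : ℂ) * covDeriv g A y k i j

/-- The vector field metrically equivalent to `δA`, `Zⁱ = gⁱʲ (δA)_j`. -/
def codiffVec (y : E4) (i : Fin 4) : ℂ :=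
  ∑ j, (((g y)⁻¹ i j : ℝ) : ℂ) * codiff g A y j

/-- `A^{ij} = gⁱᵃ gʲᵇ A_{ab}`. -/
def raiseBoth (i j : Fin 4) : ℂ :=
  ∑ a, ∑ b, (((g y)⁻¹ i a : ℝ) : ℂ) * (((g y)⁻¹ j b : ℝ) : ℂ) * A y a b

/-- Hodge dual of a two-form, `(*A)_{ij} = ½ η_{ijkl} A^{kl}`. -/
def hodge (i j : Fin 4) : ℂ :=
  (1 / 2) * ∑ k, ∑ l, (η y i j k l : ℂ) * raiseBoth g A y k l

/-- Metric on the self-dual two-forms, `𝒢 = ½ (G - i η)` with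
`G_{ijkl} = g_{ik} g_{jl} - g_{il} g_{jk}`. -/
def selfDualMetric (i j k l : Fin 4) : ℂ :=
  (1 / 2) * (((g y i k * g y j l - g y i l * g y j k : ℝ) : ℂ) - Complex.I * (η y i j k l : ℂ))

/-- `Aⁱ_j = gⁱᵏ A_{kj}`, the endomorphism defined by the two-form. -/
def formEnd : Matrix (Fin 4) (Fin 4) ℂ := ((g y)⁻¹).map Complex.ofReal * A y

/-- The commutator `[A, Ric] = A · Ric - Ric · A`. -/
def ricciCommutator : Matrix (Fin 4) (Fin 4) ℂ :=
  formEnd g A y * (ricciEnd g y).map Complex.ofReal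
    - (ricciEnd g y).map Complex.ofReal * formEnd g A y

/-- The scalar product `(A, A) = ½ A_{ij} A^{ij}`. -/
def formSq : ℂ := (1 / 2) * ∑ i, ∑ j, A y i j * raiseBoth g A y i j

/-- The structure tensor `Π = 2 U · Ū` of a non-null self-dual two-form `A`, where `U` is the
unitary two-form proportional to `A`: `A = e^λ U` with `(U, U) = -1`, so that
`|e^λ|² = |(A, A)|`. -/
def structureTensor : Matrix (Fin 4) (Fin 4) ℂ :=
  ((2 / ‖formSq g A y‖ : ℝ) : ℂ) • (formEnd g A y * (formEnd g A y).map (starRingEnd ℂ))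

/-- Lie derivative of the metric along a complex vector field `Z`. -/
def lieMetric (Z : E4 → Fin 4 → ℂ) (i j : Fin 4) : ℂ :=
  ∑ k, (Z y k * ((pd k (fun x => g x i j) y : ℝ) : ℂ)
    + (g y k j : ℂ) * pd i (fun x => Z x k) y + (g y i k : ℂ) * pd j (fun x => Z x k) y)

end CoordCalc

/-! ## Segre types of a real endomorphism in dimension four -/

/-- Segre type `[(1111)]`: a multiple of the identity. -/
def SegreQuadruple (R : Matrix (Fin 4) (Fin 4) ℝ) : Prop :=
  ∃ Λ : ℝ, R = Λ • (1 : Matrix (Fin 4) (Fin 4) ℝ)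

/-- Segre type `[(11)(11)]`: two distinct real eigenvalues, each with a two-dimensional
eigenspace. -/
def SegreTwoDouble (R : Matrix (Fin 4) (Fin 4) ℝ) : Prop :=
  ∃ a b : ℝ, a ≠ b ∧ Module.finrank ℝ (Module.End.eigenspace (Matrix.toLin' R) a) = 2 ∧
    Module.finrank ℝ (Module.End.eigenspace (Matrix.toLin' R) b) = 2

/-- Segre type `[(211)]`: a single real eigenvalue, with Jordan blocks of sizes 2, 1, 1. -/
def SegreTwoOneOne (R : Matrix (Fin 4) (Fin 4) ℝ) : Prop :=
  ∃ Λ : ℝ, (R - Λ • (1 : Matrix (Fin 4) (Fin 4) ℝ)) ^ 2 = 0 ∧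
    Module.finrank ℝ (Module.End.eigenspace (Matrix.toLin' R) Λ) = 3

/-! ## Space-times -/

section SpaceTimes

variable {M : Type*} [TopologicalSpace M] [ChartedSpace CoordCalc.E4 M]

/-- The coordinate vector `∂ᵢ` of the chart `φ` at the point with coordinates `y`. -/
def coordVec (φ : OpenPartialHomeomorph M CoordCalc.E4) (y : CoordCalc.E4) (i : Fin 4) :
    TangentSpace (𝓡 4) (φ.symm y) :=
  mfderiv (𝓡 4) (𝓡 4) φ.symm y (EuclideanSpace.single i (1 : ℝ) : CoordCalc.E4)

/-- Components `g_{ij}` of a field of bilinear forms in the chart `φ`. -/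
def metricComp (g : ∀ p : M, TangentSpace (𝓡 4) p →L[ℝ] TangentSpace (𝓡 4) p →L[ℝ] ℝ)
    (φ : OpenPartialHomeomorph M CoordCalc.E4) (y : CoordCalc.E4) : Matrix (Fin 4) (Fin 4) ℝ :=
  Matrix.of fun i j => g (φ.symm y) (coordVec φ y i) (coordVec φ y j)

/-- Components `η_{ijkl}` of a four-form in the chart `φ`. -/
def volComp (η : ∀ p : M, TangentSpace (𝓡 4) p [⋀^Fin 4]→L[ℝ] ℝ)
    (φ : OpenPartialHomeomorph M CoordCalc.E4) (y : CoordCalc.E4) (i j k l : Fin 4) : ℝ :=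
  η (φ.symm y) ![coordVec φ y i, coordVec φ y j, coordVec φ y k, coordVec φ y l]

/-- Components `A_{ij}` of a complex two-form in the chart `φ`. -/
def formComp (A : ∀ p : M, TangentSpace (𝓡 4) p [⋀^Fin 2]→L[ℝ] ℂ)
    (φ : OpenPartialHomeomorph M CoordCalc.E4) (y : CoordCalc.E4) : Matrix (Fin 4) (Fin 4) ℂ :=
  Matrix.of fun i j => A (φ.symm y) ![coordVec φ y i, coordVec φ y j]

variable (M) in
/-- An oriented space-time: a smooth metric `g` of signature `(-,+,+,+)` on the smooth
four-manifold `M`, together with a smooth metric volume element `η` (which is the same thing as an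
orientation). -/
structure SpaceTime [IsManifold (𝓡 4) ∞ M] where
  /-- the metric -/
  g : ∀ p : M, TangentSpace (𝓡 4) p →L[ℝ] TangentSpace (𝓡 4) p →L[ℝ] ℝ
  /-- the metric volume element -/
  η : ∀ p : M, TangentSpace (𝓡 4) p [⋀^Fin 4]→L[ℝ] ℝ
  symm : ∀ p v w, g p v w = g p w v
  signature : ∀ p, ∃ b : Module.Basis (Fin 4) ℝ (TangentSpace (𝓡 4) p), ∀ i j,
    g p (b i) (b j) = if i = j then (if i = 0 then -1 else 1) else 0
  vol_sq : ∀ p (v : Fin 4 → TangentSpace (𝓡 4) p),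
    η p v ^ 2 = -(Matrix.of fun i j => g p (v i) (v j)).det
  smooth_g : ∀ φ ∈ IsManifold.maximalAtlas (𝓡 4) ∞ M, ∀ i j,
    ContDiffOn ℝ ∞ (fun y => metricComp g φ y i j) φ.target
  smooth_η : ∀ φ ∈ IsManifold.maximalAtlas (𝓡 4) ∞ M, ∀ i j k l,
    ContDiffOn ℝ ∞ (fun y => volComp η φ y i j k l) φ.target

variable [IsManifold (𝓡 4) ∞ M]

/-- A conformal Killing–Yano tensor in self-dual form: a smooth complex two-form `𝒜` with
`*𝒜 = i 𝒜` and `3 ∇𝒜 = 2 i(𝒵)𝒢`, `𝒵 = δ𝒜`. -/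
structure IsConformalKillingYano (S : SpaceTime M)
    (A : ∀ p : M, TangentSpace (𝓡 4) p [⋀^Fin 2]→L[ℝ] ℂ) : Prop where
  smooth : ∀ φ ∈ IsManifold.maximalAtlas (𝓡 4) ∞ M, ∀ i j,
    ContDiffOn ℝ ∞ (fun y => formComp A φ y i j) φ.target
  selfDual : ∀ φ ∈ IsManifold.maximalAtlas (𝓡 4) ∞ M, ∀ y ∈ φ.target, ∀ i j,
    CoordCalc.hodge (metricComp S.g φ) (volComp S.η φ) (formComp A φ) y i j
      = Complex.I * formComp A φ y i j
  equation : ∀ φ ∈ IsManifold.maximalAtlas (𝓡 4) ∞ M, ∀ y ∈ φ.target, ∀ k i j,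
    3 * CoordCalc.covDeriv (metricComp S.g φ) (formComp A φ) y k i j
      = 2 * ∑ d, CoordCalc.codiffVec (metricComp S.g φ) (formComp A φ) y d
          * CoordCalc.selfDualMetric (metricComp S.g φ) (volComp S.η φ) y d k i j

/-- A complex vector field, given by its components `Z φ` in every chart `φ`, is a Killing vector
(the zero field included): `ℒ_Z g = 0`. -/
def IsKilling (S : SpaceTime M)
    (Z : OpenPartialHomeomorph M CoordCalc.E4 → CoordCalc.E4 → Fin 4 → ℂ) : Prop :=
  ∀ φ ∈ IsManifold.maximalAtlas (𝓡 4) ∞ M, ∀ y ∈ φ.target, ∀ i j,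
    CoordCalc.lieMetric (metricComp S.g φ) y (Z φ) i j = 0

/-- The complex vector field `𝒵 = δ𝒜`, by its components in every chart. -/
def divergenceField (S : SpaceTime M) (A : ∀ p : M, TangentSpace (𝓡 4) p [⋀^Fin 2]→L[ℝ] ℂ) :
    OpenPartialHomeomorph M CoordCalc.E4 → CoordCalc.E4 → Fin 4 → ℂ :=
  fun φ => CoordCalc.codiffVec (metricComp S.g φ) (formComp A φ)

end SpaceTimes

end

/-! Differential part. Subtracting from `∇A` its trace part, `(1/3)(Z_i g_{kj} - Z_j g_{ki})` with
`Z = δA`, leaves a tensor `T`. The conformal Killing–Yano equation says that `T` is a multiple of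
`i(Z)η`, hence totally antisymmetric. Insert this decomposition into the Ricci identity for `[∇_m,
∇_k] A_{ij}`, contract `k` with `i`, and symmetrise in `m`, `j`. The terms from `∇T` drop out by
antisymmetry, and so does the full Riemann term, by pair symmetry. What is left relates `∇_m Z_j +
∇_j Z_m + (div Z) g_{mj}` to Ricci times `A`. Its trace pairs the symmetric Ricci tensor with a
two-form, so `div Z = 0`. The outcome is `L_Z g = -(3/2) g·[A, Ric]` (`lieMetric_codiffVec`), and
(1) follows because `g` is invertible.

Algebraic part. In an orthonormal frame a self-dual form is a matrix `K = Σ a_j E_j`, where the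
`E_j` anticommute, square to the identity, and commute with the matrices `Ē_k` of the opposite
duality. A symmetric endomorphism is `R = α + Σ r_{jk} E_j Ē_k`, with `r` hermitian when `R` is
real. Then `[K, R] = 0` says that every column of `r` is parallel to `a`, so `r = β a a†` and `R = α
+ β K K̄` with `α`, `β` real (`eq_of_commute_selfDualEnd`).

The Segrè types are read off from `S = K K̄`. Since `K² = q` is scalar and `K`, `K̄` commute, `S² =
|q|²`; moreover `S` is trace-free. If `q ≠ 0`, then `S` has eigenvalues `±|q|`, each of multiplicity
two. If `q = 0`, then `S` is self-adjoint with `S² = 0`; Lorentzian signature forces rank one, so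
`S` is a multiple of `ℓ ⊗ ℓ` with `ℓ` null and killed by `K`. The converse directions are direct
commutations. -/

noncomputable section

namespace CoordCalc

/-! ### Linear connections in coordinates. -/

section Connection

variable (G : E4 → Fin 4 → Fin 4 → Fin 4 → ℂ)

/-- Covariant derivative `∇ₖ Zᵢ` of a one-form, for the connection coefficients `G`. -/
def nablaOne (Z : E4 → Fin 4 → ℂ) (y : E4) (k i : Fin 4) : ℂ :=
  pd k (fun x => Z x i) y - ∑ l, G y l k i * Z y l

/-- Covariant derivative `∇ₖ Bᵢⱼ` of a two-tensor. -/
def nablaTwo (B : E4 → Matrix (Fin 4) (Fin 4) ℂ) (y : E4) (k i j : Fin 4) : ℂ :=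
  pd k (fun x => B x i j) y - ∑ l, (G y l k i * B y l j + G y l k j * B y i l)

/-- Covariant derivative `∇ₘ Tₖᵢⱼ` of a three-tensor. -/
def nablaThree (T : E4 → Fin 4 → Fin 4 → Fin 4 → ℂ) (y : E4) (m k i j : Fin 4) : ℂ :=
  pd m (fun x => T x k i j) y
    - ∑ l, (G y l m k * T y l i j + G y l m i * T y k l j + G y l m j * T y k i l)

/-- Curvature `Rᵃ_{bcd}` of the connection. -/
def curvature (y : E4) (a b c d : Fin 4) : ℂ :=
  pd c (fun x => G x a d b) y - pd d (fun x => G x a c b) y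
    + ∑ e, (G y a c e * G y e d b - G y a d e * G y e c b)

end Connection

/-! ### Calculus of partial derivatives. -/

section PartialDerivatives

variable {f h : E4 → ℂ} {y : E4} (k : Fin 4)

theorem pd_add (hf : DifferentiableAt ℝ f y) (hh : DifferentiableAt ℝ h y) :
    pd k (fun x => f x + h x) y = pd k f y + pd k h y := by
  simp [pd, fderiv_fun_add hf hh]

theorem pd_sub (hf : DifferentiableAt ℝ f y) (hh : DifferentiableAt ℝ h y) :
    pd k (fun x => f x - h x) y = pd k f y - pd k h y := by
  simp [pd, fderiv_fun_sub hf hh]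

theorem pd_mul (hf : DifferentiableAt ℝ f y) (hh : DifferentiableAt ℝ h y) :
    pd k (fun x => f x * h x) y = pd k f y * h y + f y * pd k h y := by
  simp [pd, fderiv_fun_mul hf hh]; ring

theorem pd_sum {F : Fin 4 → E4 → ℂ} (hF : ∀ i, DifferentiableAt ℝ (F i) y) :
    pd k (fun x => ∑ i, F i x) y = ∑ i, pd k (F i) y := by
  simp [pd, fderiv_fun_sum (fun i _ => hF i)]

theorem pd_congr {f h : E4 → ℂ} (e : f =ᶠ[nhds y] h) : pd k f y = pd k h y := by
  simp [pd, e.fderiv_eq]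

theorem pd_neg : pd k (fun x => -f x) y = -pd k f y := by
  simp [pd, fderiv_fun_neg]

theorem pd_ofReal {f : E4 → ℝ} (hf : DifferentiableAt ℝ f y) :
    pd k (fun x => (f x : ℂ)) y = (pd k f y : ℝ) := by
  have := (Complex.ofRealCLM.hasFDerivAt.comp y hf.hasFDerivAt).fderiv
  simp only [pd]
  erw [this]
  rfl

theorem contDiffAt_pd {F : Type} [NormedAddCommGroup F] [NormedSpace ℝ F] {f : E4 → F}
    (hf : ContDiffAt ℝ ∞ f y) : ContDiffAt ℝ ∞ (pd k f) y := by
  unfold pd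
  exact (hf.fderiv_right (m := ∞) (by simp)).clm_apply contDiffAt_const

theorem pd_comm (hf : ContDiffAt ℝ ∞ f y) (m : Fin 4) :
    pd m (pd k f) y = pd k (pd m f) y := by
  have hs : IsSymmSndFDerivAt ℝ f y := hf.isSymmSndFDerivAt (by simp; exact WithTop.coe_le_coe.2 le_top)
  have hd : DifferentiableAt ℝ (fderiv ℝ f) y :=
    (hf.fderiv_right (m := ∞) (by simp)).differentiableAt (by simp)
  have key : ∀ a b : Fin 4, pd a (pd b f) y
      = fderiv ℝ (fderiv ℝ f) y (EuclideanSpace.single a 1) (EuclideanSpace.single b 1) := by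
    intro a b
    unfold pd
    rw [fderiv_clm_apply hd (differentiableAt_const _)]
    simp
  rw [key, key]
  exact hs _ _

end PartialDerivatives

/-! ### Ricci and Bianchi identities of a torsion-free connection. -/

/-- The Ricci identity for two-tensors. -/
theorem ricci_identity {G : E4 → Fin 4 → Fin 4 → Fin 4 → ℂ}
    {B : E4 → Matrix (Fin 4) (Fin 4) ℂ} {y : E4}
    (hG : ∀ a b c, DifferentiableAt ℝ (fun x => G x a b c) y)
    (hsymm : ∀ a b c, G y a b c = G y a c b)
    (hB : ∀ i j, ContDiffAt ℝ ∞ (fun x => B x i j) y) (m k i j : Fin 4) :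
    nablaThree G (nablaTwo G B) y m k i j - nablaThree G (nablaTwo G B) y k m i j
      = -∑ l, (curvature G y l i m k * B y l j + curvature G y l j m k * B y i l) := by
  have hB1 : ∀ i j, DifferentiableAt ℝ (fun x => B x i j) y := fun i j =>
    (hB i j).differentiableAt (by simp)
  have hB2 : ∀ k i j, DifferentiableAt ℝ (pd k (fun x => B x i j)) y := fun k i j =>
    (contDiffAt_pd k (hB i j)).differentiableAt (by simp)
  have expand : ∀ m k, pd m (fun x => nablaTwo G B x k i j) y
      = pd m (pd k (fun x => B x i j)) y
        - ∑ l, ((pd m (fun x => G x l k i) y * B y l j + G y l k i * pd m (fun x => B x l j) y)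
          + (pd m (fun x => G x l k j) y * B y i l + G y l k j * pd m (fun x => B x i l) y)) := by
    intro m k
    have h1 : ∀ l, DifferentiableAt ℝ (fun x => G x l k i * B x l j) y :=
      fun l => (hG l k i).mul (hB1 l j)
    have h2 : ∀ l, DifferentiableAt ℝ (fun x => G x l k j * B x i l) y :=
      fun l => (hG l k j).mul (hB1 i l)
    have h3 := pd_sum (y := y) m (F := fun l x => G x l k i * B x l j + G x l k j * B x i l)
      (fun l => (h1 l).add (h2 l))
    have h4 := pd_sub (y := y) m (hB2 k i j)
      (h := fun x => ∑ l, (G x l k i * B x l j + G x l k j * B x i l))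
      (DifferentiableAt.fun_sum fun l _ => (h1 l).add (h2 l))
    unfold nablaTwo
    rw [h4, h3]
    congr 1
    refine Finset.sum_congr rfl fun l _ => ?_
    rw [pd_add m (h1 l) (h2 l), pd_mul m (hG l k i) (hB1 l j), pd_mul m (hG l k j) (hB1 i l)]
  have hmk : ∀ l, G y l m k = G y l k m := fun l => hsymm l m k
  unfold nablaThree
  rw [expand, expand, pd_comm k (hB i j) m]
  unfold nablaTwo curvature
  simp only [hmk, Fin.sum_univ_four]
  ring

/-- First Bianchi identity. -/
theorem curvature_cyclic {G : E4 → Fin 4 → Fin 4 → Fin 4 → ℂ} {y : E4}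
    (hsymm : ∀ x a b c, G x a b c = G x a c b) (a b c d : Fin 4) :
    curvature G y a b c d + curvature G y a c d b + curvature G y a d b c = 0 := by
  have e : ∀ p q, (fun x => G x a p q) = fun x => G x a q p := fun p q =>
    funext fun x => hsymm x a p q
  unfold curvature
  rw [e d b, e c b, e d c]
  simp only [hsymm y _ d b, hsymm y _ c b, hsymm y _ d c, Fin.sum_univ_four]
  ring

theorem curvature_antisymm (G : E4 → Fin 4 → Fin 4 → Fin 4 → ℂ) (y : E4) (a b c d : Fin 4) :
    curvature G y a b c d = -curvature G y a b d c := by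
  unfold curvature
  simp only [Fin.sum_univ_four]
  ring

/-! ### The Levi-Civita connection and the symmetries of its curvature. -/

section LeviCivita

variable {g : E4 → Matrix (Fin 4) (Fin 4) ℝ} {y : E4}

variable (g) in
/-- The Christoffel symbols as complex connection coefficients. -/
def leviCivita (x : E4) (a b c : Fin 4) : ℂ := (christoffel g x a b c : ℂ)

variable (g) in
/-- The metric components as complex numbers. -/
def metricC (x : E4) : Matrix (Fin 4) (Fin 4) ℂ := (g x).map Complex.ofReal

variable (g) in
/-- The inverse metric as a complex matrix. -/
def invMetricC (x : E4) : Matrix (Fin 4) (Fin 4) ℂ := ((g x)⁻¹).map Complex.ofReal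

theorem contDiffAt_inv (hg : ∀ i j, ContDiffAt ℝ ∞ (fun x => g x i j) y)
    (hdet : (g y).det ≠ 0) (i j : Fin 4) : ContDiffAt ℝ ∞ (fun x => (g x)⁻¹ i j) y := by
  have key : ∀ F : E4 → Matrix (Fin 4) (Fin 4) ℝ, (∀ i j, ContDiffAt ℝ ∞ (fun x => F x i j) y) →
      ContDiffAt ℝ ∞ (fun x => (F x).det) y := by
    intro F hF
    simp only [Matrix.det_apply, Units.smul_def, zsmul_eq_mul]
    exact ContDiffAt.sum fun σ _ => contDiffAt_const.mul (contDiffAt_prod fun i _ => hF _ _)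
  have e : (fun x => (g x)⁻¹ i j) = fun x => (g x).det⁻¹ * (g x).adjugate i j := by
    funext x
    rw [Matrix.inv_def, Ring.inverse_eq_inv', Matrix.smul_apply, smul_eq_mul]
  rw [e]
  refine ((key g hg).inv hdet).mul ?_
  simp only [Matrix.adjugate_apply]
  refine key _ fun a b => ?_
  simp only [Matrix.updateRow_apply]
  split_ifs
  · exact contDiffAt_const
  · exact hg a b

theorem contDiffAt_christoffel (hg : ∀ i j, ContDiffAt ℝ ∞ (fun x => g x i j) y)
    (hdet : (g y).det ≠ 0) (a b c : Fin 4) :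
    ContDiffAt ℝ ∞ (fun x => christoffel g x a b c) y := by
  unfold christoffel
  refine contDiffAt_const.mul (ContDiffAt.sum fun l _ => ?_)
  exact (contDiffAt_inv hg hdet a l).mul
    (((contDiffAt_pd b (hg c l)).add (contDiffAt_pd c (hg b l))).sub (contDiffAt_pd l (hg b c)))

theorem contDiffAt_ofReal {f : E4 → ℝ} (hf : ContDiffAt ℝ ∞ f y) :
    ContDiffAt ℝ ∞ (fun x => (f x : ℂ)) y :=
  Complex.ofRealCLM.contDiff.contDiffAt.comp y hf

theorem christoffel_symm (hs : ∀ x i j, g x i j = g x j i) (x : E4) (a b c : Fin 4) :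
    christoffel g x a b c = christoffel g x a c b := by
  unfold christoffel
  congr 1
  refine Finset.sum_congr rfl fun l _ => ?_
  have : (fun x => g x b c) = fun x => g x c b := funext fun x => hs x b c
  rw [this]
  ring

theorem ofReal_riemann (hg : ∀ i j, ContDiffAt ℝ ∞ (fun x => g x i j) y)
    (hdet : (g y).det ≠ 0) (hs : ∀ x i j, g x i j = g x j i) (a b c d : Fin 4) :
    (riemann g y a b c d : ℂ) = curvature (leviCivita g) y a b c d := by
  have hd : ∀ a b c, DifferentiableAt ℝ (fun x => christoffel g x a b c) y := fun a b c =>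
    (contDiffAt_christoffel hg hdet a b c).differentiableAt (by simp)
  have e : ∀ b c, (fun x => christoffel g x a b c) = fun x => christoffel g x a c b :=
    fun b c => funext fun x => christoffel_symm hs x a b c
  unfold riemann curvature leviCivita
  rw [pd_ofReal c (hd a d b), pd_ofReal d (hd a c b), e b d, e b c]
  push_cast
  simp only [christoffel_symm hs y _ b]

theorem lower_christoffel (hdet : (g y).det ≠ 0)
    (i j k : Fin 4) :
    ∑ l, g y i l * christoffel g y l j k
      = (1 / 2) * (pd j (fun x => g x k i) y + pd k (fun x => g x j i) y
        - pd i (fun x => g x j k) y) := by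
  have h : g y * (g y)⁻¹ = 1 := Matrix.mul_nonsing_inv _ (isUnit_iff_ne_zero.2 hdet)
  unfold christoffel
  calc _ = (1 / 2) * ∑ m, (g y * (g y)⁻¹) i m * (pd j (fun x => g x k m) y
        + pd k (fun x => g x j m) y - pd m (fun x => g x j k) y) := by
        simp only [Matrix.mul_apply, Finset.mul_sum, Finset.sum_mul]
        rw [Finset.sum_comm]
        refine Finset.sum_congr rfl fun m _ => Finset.sum_congr rfl fun l _ => by ring
    _ = _ := by
        rw [h]
        simp [Matrix.one_apply]

/-- The lowered symbols `Γ_{jki}` and `Γ_{ikj}` add up to `∂_k g_{ij}`, the other derivatives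
cancelling in pairs. -/
theorem nablaTwo_metricC (hg : ∀ i j, ContDiffAt ℝ ∞ (fun x => g x i j) y)
    (hdet : (g y).det ≠ 0) (hs : ∀ x i j, g x i j = g x j i) (k i j : Fin 4) :
    nablaTwo (leviCivita g) (metricC g) y k i j = 0 := by
  have e : ∀ b c, (fun x => g x b c) = fun x => g x c b := fun b c => funext fun x => hs x b c
  have h1 := lower_christoffel (y := y) hdet j k i
  have h2 := lower_christoffel (y := y) hdet i k j
  have hr : pd k (fun x => g x i j) y
      - ∑ l, (christoffel g y l k i * g y l j + christoffel g y l k j * g y i l) = 0 := by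
    rw [Finset.sum_add_distrib]
    have h3 : ∑ l, christoffel g y l k i * g y l j = ∑ l, g y j l * christoffel g y l k i :=
      Finset.sum_congr rfl fun l _ => by rw [hs y j l, mul_comm]
    have h4 : ∑ l, christoffel g y l k j * g y i l = ∑ l, g y i l * christoffel g y l k j :=
      Finset.sum_congr rfl fun l _ => by rw [mul_comm]
    rw [h3, h4, h1, h2, e j i, e k i, e k j]
    ring
  unfold nablaTwo leviCivita metricC
  simp only [Matrix.map_apply]
  rw [pd_ofReal k ((hg i j).differentiableAt (by simp))]
  exact_mod_cast hr

/-- The Riemann tensor with all indices down. -/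
def lowerCurvature (g : E4 → Matrix (Fin 4) (Fin 4) ℝ) (y : E4) (a b c d : Fin 4) : ℂ :=
  ∑ l, metricC g y a l * curvature (leviCivita g) y l b c d

/-- The Ricci identity applied to the parallel tensor `g` gives skewness in the first index pair.
Skewness in the second pair and the cyclic identity then force pair symmetry, by the classical
combination of four cyclic sums. -/
theorem lowerCurvature_pair_symm {U : Set E4} (hU : IsOpen U) (hy : y ∈ U)
    (hg : ∀ x ∈ U, ∀ i j, ContDiffAt ℝ ∞ (fun x => g x i j) x)
    (hdet : ∀ x ∈ U, (g x).det ≠ 0) (hs : ∀ x i j, g x i j = g x j i) (a b c d : Fin 4) :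
    lowerCurvature g y a b c d = lowerCurvature g y c d a b := by
  have hsym : ∀ x a b c, leviCivita g x a b c = leviCivita g x a c b := fun x a b c => by
    unfold leviCivita; rw [christoffel_symm hs]
  have hzero : ∀ m k i j, nablaThree (leviCivita g) (nablaTwo (leviCivita g) (metricC g)) y m k i j
      = 0 := by
    intro m k i j
    -- `∇g` must vanish near `y` and not only at `y`, because it is differentiated once more.
    have h0 : ∀ x ∈ U, ∀ k i j, nablaTwo (leviCivita g) (metricC g) x k i j = 0 :=
      fun x hx => nablaTwo_metricC (hg x hx) (hdet x hx) hs
    unfold nablaThree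
    have : pd m (fun x => nablaTwo (leviCivita g) (metricC g) x k i j) y = 0 := by
      rw [pd_congr (h := fun _ => 0) m (Filter.eventuallyEq_of_mem (hU.mem_nhds hy)
        fun x hx => h0 x hx k i j)]
      simp [pd]
    rw [this]
    simp [h0 y hy]
  have hanti : ∀ a b c d, lowerCurvature g y a b c d = -lowerCurvature g y b a c d := by
    intro a b c d
    have := ricci_identity (G := leviCivita g) (B := metricC g) (y := y)
      (fun a b c => (contDiffAt_ofReal
        (contDiffAt_christoffel (hg y hy) (hdet y hy) a b c)).differentiableAt (by simp))
      (hsym y) (fun i j => contDiffAt_ofReal (hg y hy i j)) c d b a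
    rw [hzero, hzero, sub_zero, eq_comm, neg_eq_zero, Finset.sum_add_distrib] at this
    unfold lowerCurvature
    rw [eq_neg_iff_add_eq_zero, ← this]
    congr 1 <;> refine Finset.sum_congr rfl fun l _ => ?_
    · simp only [metricC, Matrix.map_apply, hs y a l]; ring
    · ring
  have hanti' : ∀ a b c d, lowerCurvature g y a b c d = -lowerCurvature g y a b d c := by
    intro a b c d
    unfold lowerCurvature
    rw [← Finset.sum_neg_distrib]
    exact Finset.sum_congr rfl fun l _ => by rw [curvature_antisymm]; ring
  have hcyc : ∀ a b c d, lowerCurvature g y a b c d + lowerCurvature g y a c d b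
      + lowerCurvature g y a d b c = 0 := by
    intro a b c d
    unfold lowerCurvature
    rw [← Finset.sum_add_distrib, ← Finset.sum_add_distrib]
    refine Finset.sum_eq_zero fun l _ => ?_
    rw [← mul_add, ← mul_add, curvature_cyclic hsym, mul_zero]
  have h1 := hcyc a b c d
  have h2 := hcyc b c d a
  have h3 := hcyc c d a b
  have h4 := hcyc d a b c
  rw [hanti' a c d b] at h1
  rw [hanti' b c d a, hanti b a c d] at h2
  rw [hanti c a b d, hanti c b d a, hanti' b c d a] at h3
  rw [hanti d a b c, hanti d b c a, hanti' b d c a, hanti d c a b] at h4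
  linear_combination (1 / 2 : ℂ) * (h1 - h2 - h3 + h4)

end LeviCivita

/-! ### Contraction of the Ricci identity, as pure index algebra at one point. -/

section Contraction

variable {gl gi : Matrix (Fin 4) (Fin 4) ℂ}

theorem sum_symm_mul_antisymm {s f : Fin 4 → Fin 4 → ℂ} (hs : ∀ i j, s i j = s j i)
    (hf : ∀ i j, f i j = -f j i) : ∑ i, ∑ j, s i j * f i j = 0 := by
  have h : ∑ i, ∑ j, s i j * f i j = -∑ i, ∑ j, s i j * f i j := by
    conv_lhs => rw [Finset.sum_comm]
    simp only [← Finset.sum_neg_distrib]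
    refine Finset.sum_congr rfl fun i _ => Finset.sum_congr rfl fun j _ => ?_
    rw [hs, hf]; ring
  exact self_eq_neg.1 h

theorem sum_mul_lower (hinv : gi * gl = 1) (f : Fin 4 → ℂ) (j : Fin 4) :
    ∑ i, f i * ∑ k, gi i k * gl k j = f j := by
  have : ∀ i, ∑ k, gi i k * gl k j = (1 : Matrix (Fin 4) (Fin 4) ℂ) i j := fun i => by
    rw [← hinv, Matrix.mul_apply]
  simp [this, Matrix.one_apply]

/-- Reversing the order of summation lets two sums be compared after the renaming `k ↔ e`, `i ↔ l`,
as the last claim of `contract_curvature` requires. -/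
theorem sum_reverse (F : Fin 4 → Fin 4 → Fin 4 → Fin 4 → ℂ) :
    ∑ k, ∑ i, ∑ l, ∑ e, F k i l e = ∑ e, ∑ l, ∑ i, ∑ k, F k i l e := by
  have h3 : ∀ H : Fin 4 → Fin 4 → Fin 4 → ℂ, ∑ i, ∑ l, ∑ e, H i l e = ∑ e, ∑ l, ∑ i, H i l e := by
    intro H
    rw [Finset.sum_comm]
    conv_lhs => enter [2, l]; rw [Finset.sum_comm]
    rw [Finset.sum_comm]
  conv_lhs => enter [2, k]; rw [h3]
  rw [Finset.sum_comm]
  refine Finset.sum_congr rfl fun e _ => ?_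
  rw [Finset.sum_comm]
  exact Finset.sum_congr rfl fun l _ => Finset.sum_comm

variable {C : Fin 4 → Fin 4 → Fin 4 → Fin 4 → ℂ}

/-- All three claims are read off from the lowered curvature `L`. For the last, `L_{ejmk} = L_{mkej}
= L_{kmje}`, and renaming the summed indices turns `A_{il}` into `A_{li}`, which supplies the sign.
The first claim turns one curvature term of the Ricci identity into Ricci; the last makes the other
one vanish on symmetrising. -/
theorem contract_curvature (hinv : gi * gl = 1) (hgi : ∀ i j, gi i j = gi j i)
    (hanti : ∀ a b c d, C a b c d = -C a b d c)
    (hpair : ∀ a b c d, ∑ l, gl a l * C l b c d = ∑ l, gl c l * C l d a b) :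
    (∀ l m, ∑ k, ∑ i, gi k i * C l i m k = ∑ a, gi l a * ∑ e, C e a e m) ∧
    (∀ b d, ∑ a, C a b a d = ∑ a, C a d a b) ∧
    (∀ A : Matrix (Fin 4) (Fin 4) ℂ, (∀ i j, A i j = -A j i) → ∀ m j,
      ∑ k, ∑ i, gi k i * ∑ l, C l j m k * A i l
        = -∑ k, ∑ i, gi k i * ∑ l, C l m j k * A i l) := by
  obtain ⟨L, hL⟩ : ∃ L : Fin 4 → Fin 4 → Fin 4 → Fin 4 → ℂ,
    ∀ a b c d, L a b c d = ∑ l, gl a l * C l b c d := ⟨_, fun _ _ _ _ => rfl⟩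
  have hCL : ∀ a b c d, C a b c d = ∑ e, gi a e * L e b c d := by
    intro a b c d
    have h := sum_mul_lower (gi := gl.transpose) (gl := gi.transpose)
      (by rw [← Matrix.transpose_mul, hinv, Matrix.transpose_one]) (fun l => C l b c d) a
    rw [← h]
    simp only [hL, Matrix.transpose_apply, Finset.mul_sum]
    rw [Finset.sum_comm]
    exact Finset.sum_congr rfl fun i _ => Finset.sum_congr rfl fun j _ => by ring
  have hp : ∀ a b c d, L a b c d = L c d a b := fun a b c d => by rw [hL, hL, hpair]
  have ha : ∀ a b c d, L a b c d = -L a b d c := fun a b c d => by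
    rw [hL, hL, ← Finset.sum_neg_distrib]
    exact Finset.sum_congr rfl fun l _ => by rw [hanti]; ring
  have ha' : ∀ a b c d, L a b c d = -L b a c d := fun a b c d => by rw [hp, ha, hp c d]
  refine ⟨fun l m => ?_, fun b d => ?_, fun A hA m j => ?_⟩
  · have h1 : ∀ a, ∑ e, C e a e m = ∑ k, ∑ i, gi k i * L a i m k := fun a => by
      refine Finset.sum_congr rfl fun k _ => ?_
      rw [hCL]
      refine Finset.sum_congr rfl fun i _ => ?_
      rw [ha', ha, neg_neg]
    simp only [h1, hCL l, Finset.mul_sum]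
    conv_lhs => enter [2, k]; rw [Finset.sum_comm]
    rw [Finset.sum_comm]
    refine Finset.sum_congr rfl fun a _ => ?_
    exact Finset.sum_congr rfl fun k _ => Finset.sum_congr rfl fun i _ => by ring
  · simp only [hCL]
    rw [Finset.sum_comm]
    refine Finset.sum_congr rfl fun e _ => Finset.sum_congr rfl fun a _ => ?_
    rw [hgi, hp]
  · simp only [hCL, Finset.mul_sum, Finset.sum_mul, ← Finset.sum_neg_distrib]
    rw [sum_reverse]
    refine Finset.sum_congr rfl fun e _ => Finset.sum_congr rfl fun l _ =>
      Finset.sum_congr rfl fun i _ => Finset.sum_congr rfl fun k _ => ?_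
    rw [hA i l, hp e, ha', ha, hgi e l, hgi k i, neg_neg]
    ring

/-- Here `z` stands for `∇Z`, `X` for `∇∇A`, `D` for the derivative of the trace-free part of `∇A`,
and `C` for the curvature. -/
theorem contract_killing_equation (hinv : gi * gl = 1) (hgi : ∀ i j, gi i j = gi j i)
    (hgl : ∀ i j, gl i j = gl j i)
    (hanti : ∀ a b c d, C a b c d = -C a b d c)
    (hpair : ∀ a b c d, ∑ l, gl a l * C l b c d = ∑ l, gl c l * C l d a b)
    {A z : Matrix (Fin 4) (Fin 4) ℂ} (hA : ∀ i j, A i j = -A j i)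
    {X D : Fin 4 → Fin 4 → Fin 4 → Fin 4 → ℂ}
    (hD1 : ∀ m k i j, D m k i j = -D m i k j) (hD2 : ∀ m k i j, D m k i j = -D m k j i)
    (hX : ∀ m k i j, X m k i j = D m k i j + (1 / 3) * (z m i * gl k j - z m j * gl k i))
    (hR : ∀ m k i j, X m k i j - X k m i j = -∑ l, (C l i m k * A l j + C l j m k * A i l))
    (m j : Fin 4) :
    z m j + z j m = (3 / 2) * ∑ l, ((∑ a, gi l a * ∑ e, C e a e m) * A l j
      + (∑ a, gi l a * ∑ e, C e a e j) * A l m) := by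
  obtain ⟨hE, hRic, hV⟩ := contract_curvature hinv hgi hanti hpair
  have hS1 : ∀ m j, ∑ k, ∑ i, gi k i * D m k i j = 0 := fun m j =>
    sum_symm_mul_antisymm hgi fun k i => hD1 m k i j
  have hS2 : ∀ m j, ∑ k, ∑ i, gi k i * (z m i * gl k j) = z m j := fun m j => by
    rw [← sum_mul_lower hinv (z m) j, Finset.sum_comm]
    refine Finset.sum_congr rfl fun i _ => ?_
    rw [Finset.mul_sum]
    exact Finset.sum_congr rfl fun k _ => by rw [hgi]; ring
  have hS3 : ∀ m j, ∑ k, ∑ i, gi k i * (z k j * gl m i) = z m j := fun m j => by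
    rw [← sum_mul_lower hinv (fun k => z k j) m]
    refine Finset.sum_congr rfl fun k _ => ?_
    rw [Finset.mul_sum]
    exact Finset.sum_congr rfl fun i _ => by rw [hgl]; ring
  have hS4 : ∑ k, ∑ i, gi k i * gl k i = 4 := by
    have : ∀ k, ∑ i, gi k i * gl k i = (1 : Matrix (Fin 4) (Fin 4) ℂ) k k := fun k => by
      rw [← hinv, Matrix.mul_apply]
      exact Finset.sum_congr rfl fun i _ => by rw [hgl]
    simp [this]
  obtain ⟨div, hdiv⟩ : ∃ d, d = ∑ k, ∑ i, gi k i * z k i := ⟨_, rfl⟩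
  have hW : ∀ m j, ∑ k, ∑ i, gi k i * (X m k i j - X k m i j)
      = -z m j - ∑ k, ∑ i, gi k i * D k m i j - (1 / 3) * (div * gl m j - z m j) := by
    intro m j
    have e : ∀ k i, gi k i * (X m k i j - X k m i j) = gi k i * D m k i j
        + (1 / 3) * (gi k i * (z m i * gl k j)) - (1 / 3) * z m j * (gi k i * gl k i)
        - gi k i * D k m i j - (1 / 3) * ((gi k i * z k i) * gl m j)
        + (1 / 3) * (gi k i * (z k j * gl m i)) := fun k i => by
      rw [hX, hX]; ring
    simp only [e, Finset.sum_add_distrib, Finset.sum_sub_distrib, ← Finset.mul_sum,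
      ← Finset.sum_mul]
    rw [hS1, hS2, hS3, hS4, ← hdiv]
    ring
  -- Total antisymmetry of `D` in its last three indices makes this contraction skew in `m`, `j`, so
  -- it cancels in `key`.
  have hF : ∀ m j, ∑ k, ∑ i, gi k i * D k m i j = -∑ k, ∑ i, gi k i * D k j i m := by
    intro m j
    simp only [← Finset.sum_neg_distrib]
    refine Finset.sum_congr rfl fun k _ => Finset.sum_congr rfl fun i _ => ?_
    rw [hD1, hD2, hD1 k i j m]; ring
  have hRW : ∀ m j, ∑ k, ∑ i, gi k i * (X m k i j - X k m i j)
      = -∑ l, (∑ a, gi l a * ∑ e, C e a e m) * A l j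
        - ∑ k, ∑ i, gi k i * ∑ l, C l j m k * A i l := by
    intro m j
    have e : ∀ k i, gi k i * (X m k i j - X k m i j)
        = -(∑ l, gi k i * C l i m k * A l j) - gi k i * ∑ l, C l j m k * A i l := fun k i => by
      rw [hR, Finset.sum_add_distrib, mul_neg, mul_add, Finset.mul_sum]
      simp only [mul_assoc]; ring
    simp only [e, Finset.sum_sub_distrib, Finset.sum_neg_distrib]
    congr 2
    conv_lhs => enter [2, k]; rw [Finset.sum_comm]
    rw [Finset.sum_comm]
    refine Finset.sum_congr rfl fun l _ => ?_
    rw [← hE]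
    simp only [Finset.sum_mul]
  have key : ∀ m j, (z m j + z j m) + div * gl m j
      = (3 / 2) * ∑ l, ((∑ a, gi l a * ∑ e, C e a e m) * A l j
      + (∑ a, gi l a * ∑ e, C e a e j) * A l m) := by
    intro m j
    rw [Finset.sum_add_distrib]
    have h1 := hW m j
    have h2 := hW j m
    rw [hRW] at h1 h2
    rw [hF] at h2
    rw [hV A hA] at h2
    rw [hgl j m] at h2
    linear_combination (3 / 2 : ℂ) * h1 + (3 / 2 : ℂ) * h2
  -- The trace of `key` determines `div`: the left side contributes `2 div + 4 div`, and by `hRA`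
  -- the right side contributes nothing.
  have htr : ∑ m, ∑ j, gi m j * ((z m j + z j m) + div * gl m j) = 6 * div := by
    have e : ∀ m j, gi m j * ((z m j + z j m) + div * gl m j)
      = gi m j * z m j + gi j m * z j m + div * (gi m j * gl m j) := fun m j => by
        rw [hgi j m]; ring
    simp only [e, Finset.sum_add_distrib, ← Finset.mul_sum]
    rw [hS4, ← hdiv, Finset.sum_comm (f := fun m j => gi j m * z j m), ← hdiv]
    ring
  have hRA : ∑ m, ∑ j, gi m j * ∑ l, (∑ a, gi l a * ∑ e, C e a e m) * A l j = 0 := by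
    have e : ∑ m, ∑ j, gi m j * ∑ l, (∑ a, gi l a * ∑ e, C e a e m) * A l j
        = ∑ l, ∑ j, (∑ m, gi m j * (∑ a, gi l a * ∑ e, C e a e m)) * A l j := by
      conv_lhs => enter [2, m, 2, j]; rw [Finset.mul_sum]
      conv_lhs => enter [2, m]; rw [Finset.sum_comm]
      rw [Finset.sum_comm]
      refine Finset.sum_congr rfl fun l _ => ?_
      rw [Finset.sum_comm]
      refine Finset.sum_congr rfl fun j _ => ?_
      rw [Finset.sum_mul]
      exact Finset.sum_congr rfl fun m _ => by ring
    rw [e]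
    -- Ricci with both indices raised is symmetric and is contracted with the skew `A`.
    refine sum_symm_mul_antisymm (fun l j => ?_) hA
    simp only [Finset.mul_sum]
    rw [Finset.sum_comm]
    refine Finset.sum_congr rfl fun m _ => Finset.sum_congr rfl fun a _ => ?_
    rw [← Finset.mul_sum, ← Finset.mul_sum, ← Finset.mul_sum, ← Finset.mul_sum, hRic a m, hgi m l,
      hgi j a]
    ring
  have hd : div = 0 := by
    have h : ∑ m, ∑ j, gi m j * ((z m j + z j m) + div * gl m j) = 0 := by
      have e : ∀ m j, gi m j * ((z m j + z j m) + div * gl m j)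
          = (3 / 2) * (gi m j * ∑ l, (∑ a, gi l a * ∑ e, C e a e m) * A l j)
          + (3 / 2) * (gi j m * ∑ l, (∑ a, gi l a * ∑ e, C e a e j) * A l m) := fun m j => by
        rw [key, Finset.sum_add_distrib, hgi j m]; ring
      simp only [e, Finset.sum_add_distrib, ← Finset.mul_sum]
      rw [hRA, Finset.sum_comm, hRA]
      ring
    rw [htr] at h
    simpa using h
  rw [← key, hd]
  ring

end Contraction

/-! ### The Lie derivative of the metric along `δA`. -/

section KillingEquation

variable {g : E4 → Matrix (Fin 4) (Fin 4) ℝ} {A : E4 → Matrix (Fin 4) (Fin 4) ℂ} {y : E4}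

theorem contDiffAt_covDeriv (hg : ∀ i j, ContDiffAt ℝ ∞ (fun x => g x i j) y)
    (hdet : (g y).det ≠ 0) (hA : ∀ i j, ContDiffAt ℝ ∞ (fun x => A x i j) y) (k i j : Fin 4) :
    ContDiffAt ℝ ∞ (fun x => covDeriv g A x k i j) y := by
  unfold covDeriv
  refine (contDiffAt_pd k (hA i j)).sub (ContDiffAt.sum fun l _ => ?_)
  exact ((contDiffAt_ofReal (contDiffAt_christoffel hg hdet l k i)).mul (hA l j)).add
    ((contDiffAt_ofReal (contDiffAt_christoffel hg hdet l k j)).mul (hA i l))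

theorem contDiffAt_codiff (hg : ∀ i j, ContDiffAt ℝ ∞ (fun x => g x i j) y)
    (hdet : (g y).det ≠ 0) (hA : ∀ i j, ContDiffAt ℝ ∞ (fun x => A x i j) y) (j : Fin 4) :
    ContDiffAt ℝ ∞ (fun x => codiff g A x j) y := by
  unfold codiff
  exact (ContDiffAt.sum fun i _ => ContDiffAt.sum fun k _ =>
    (contDiffAt_ofReal (contDiffAt_inv hg hdet i k)).mul (contDiffAt_covDeriv hg hdet hA k i j)).neg

theorem metricC_mul_invMetricC (hdet : (g y).det ≠ 0) : metricC g y * invMetricC g y = 1 := by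
  unfold metricC invMetricC
  have h := congrArg (fun B => B.map Complex.ofRealHom)
    (Matrix.mul_nonsing_inv (g y) (isUnit_iff_ne_zero.2 hdet))
  simp only [Matrix.map_mul] at h
  exact h.trans (Matrix.map_one _ (map_zero _) (map_one _))

theorem invMetricC_symm (hs : ∀ x i j, g x i j = g x j i) (i j : Fin 4) :
    invMetricC g y i j = invMetricC g y j i := by
  have h : (g y)⁻¹.transpose = (g y)⁻¹ := by
    rw [Matrix.transpose_nonsing_inv]
    congr 1
    ext a b
    exact hs y b a
  simp only [invMetricC, Matrix.map_apply]
  rw [← h, Matrix.transpose_apply, h]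

theorem lower_codiffVec (hdet : (g y).det ≠ 0) (j : Fin 4) :
    codiff g A y j = ∑ k, (g y j k : ℂ) * codiffVec g A y k := by
  have h := metricC_mul_invMetricC (g := g) hdet
  have h' := congrFun (congrArg (· *ᵥ codiff g A y) h) j
  simp only [Matrix.one_mulVec, ← Matrix.mulVec_mulVec] at h'
  exact h'.symm

/-- The Lie derivative of the metric along `δA` in terms of the covariant derivative of the
one-form `δA`. -/
theorem lieMetric_codiffVec_eq_nabla {U : Set E4} (hU : IsOpen U) (hy : y ∈ U)
    (hg : ∀ i j, ContDiffAt ℝ ∞ (fun x => g x i j) y) (hdet : ∀ x ∈ U, (g x).det ≠ 0)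
    (hs : ∀ x i j, g x i j = g x j i)
    (hA : ∀ i j, ContDiffAt ℝ ∞ (fun x => A x i j) y) (i j : Fin 4) :
    lieMetric g y (codiffVec g A) i j
      = nablaOne (leviCivita g) (codiff g A) y i j
        + nablaOne (leviCivita g) (codiff g A) y j i := by
  have hV : ∀ k, DifferentiableAt ℝ (fun x => codiffVec g A x k) y := fun k => by
    unfold codiffVec
    exact (ContDiffAt.sum fun l _ => (contDiffAt_ofReal (contDiffAt_inv hg (hdet y hy) k l)).mul
      (contDiffAt_codiff hg (hdet y hy) hA l)).differentiableAt (by simp)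
  have hgd : ∀ i j, DifferentiableAt ℝ (fun x => g x i j) y := fun i j =>
    (hg i j).differentiableAt (by simp)
  have hgc : ∀ i j, DifferentiableAt ℝ (fun x => (g x i j : ℂ)) y := fun i j =>
    (contDiffAt_ofReal (hg i j)).differentiableAt (by simp)
  have e : ∀ b c, (fun x => g x b c) = fun x => g x c b := fun b c => funext fun x => hs x b c
  have hpd : ∀ i j, pd i (fun x => codiff g A x j) y = ∑ k,
      (((pd i (fun x => g x j k) y : ℝ) : ℂ) * codiffVec g A y k
        + (g y j k : ℂ) * pd i (fun x => codiffVec g A x k) y) := by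
    intro i j
    rw [pd_congr (h := fun x => ∑ k, (g x j k : ℂ) * codiffVec g A x k) i
      (Filter.eventuallyEq_of_mem (hU.mem_nhds hy) fun x hx => lower_codiffVec (hdet x hx) j),
      pd_sum i (F := fun k x => (g x j k : ℂ) * codiffVec g A x k) fun k => (hgc j k).mul (hV k)]
    refine Finset.sum_congr rfl fun k _ => ?_
    rw [pd_mul i (hgc j k) (hV k), pd_ofReal i (hgd j k)]
  -- Contracting with the lowered `Z` turns `Γ` into symbols of the first kind against `Z^k`. In the
  -- symmetrised sum these cancel half of the metric derivatives and leave `Z^k ∂_k g_{ij}`.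
  have hΓ : ∀ i j, ∑ l, leviCivita g y l i j * codiff g A y l = ∑ k, (((1 / 2) *
      (pd i (fun x => g x j k) y + pd j (fun x => g x i k) y - pd k (fun x => g x i j) y) : ℝ) : ℂ)
      * codiffVec g A y k := by
    intro i j
    simp only [← lower_christoffel (hdet y hy), lower_codiffVec (hdet y hy), Complex.ofReal_sum,
      Finset.mul_sum, Finset.sum_mul, leviCivita, Complex.ofReal_mul]
    rw [Finset.sum_comm]
    refine Finset.sum_congr rfl fun k _ => Finset.sum_congr rfl fun l _ => ?_
    rw [hs y l k]; ring
  unfold nablaOne lieMetric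
  rw [hpd, hpd, hΓ, hΓ, ← Finset.sum_sub_distrib, ← Finset.sum_sub_distrib,
    ← Finset.sum_add_distrib]
  refine Finset.sum_congr rfl fun k _ => ?_
  rw [e j i, hs y k j]
  push_cast
  ring

/-- If the part of `∇A` without trace is totally antisymmetric, the Lie derivative of the metric
along `δA` is, up to a factor, the commutator of `A` with the Ricci tensor. -/
theorem lieMetric_codiffVec {U : Set E4} (hU : IsOpen U) (hy : y ∈ U)
    (hg : ∀ x ∈ U, ∀ i j, ContDiffAt ℝ ∞ (fun x => g x i j) x)
    (hdet : ∀ x ∈ U, (g x).det ≠ 0) (hs : ∀ x i j, g x i j = g x j i)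
    (hA : ∀ x ∈ U, ∀ i j, ContDiffAt ℝ ∞ (fun x => A x i j) x)
    (ha : ∀ x i j, A x i j = -A x j i)
    (hT : ∀ x ∈ U, ∀ k i j, covDeriv g A x k i j
        - (1 / 3) * (codiff g A x i * g x k j - codiff g A x j * g x k i)
      = -(covDeriv g A x i k j
        - (1 / 3) * (codiff g A x k * g x i j - codiff g A x j * g x i k))) (i j : Fin 4) :
    lieMetric g y (codiffVec g A) i j
      = -(3 / 2) * (metricC g y * ricciCommutator g A y) i j := by
  have hgy := hg y hy
  have hdy := hdet y hy
  have hsym : ∀ x a b c, leviCivita g x a b c = leviCivita g x a c b := fun x a b c => by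
    unfold leviCivita; rw [christoffel_symm hs]
  -- `T` is the part of `∇A` without trace; in dimension four the factor `1/3` removes exactly the
  -- trace `-Z`.
  obtain ⟨T, hTdef⟩ : ∃ T : E4 → Fin 4 → Fin 4 → Fin 4 → ℂ, ∀ x k i j, T x k i j
    = nablaTwo (leviCivita g) A x k i j
      - (1 / 3) * (codiff g A x i * g x k j - codiff g A x j * g x k i) := ⟨_, fun _ _ _ _ => rfl⟩
  have hT12 : ∀ x ∈ U, ∀ k i j, T x k i j = -T x i k j := fun x hx k i j => by
    rw [hTdef, hTdef]; exact hT x hx k i j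
  have hT23 : ∀ x k i j, T x k i j = -T x k j i := fun x k i j => by
    have e : (fun x => A x i j) = fun x => -A x j i := funext fun x => ha x i j
    rw [hTdef, hTdef]
    unfold nablaTwo
    rw [e, pd_neg]
    have h : ∑ l, (leviCivita g x l k i * A x l j + leviCivita g x l k j * A x i l)
        = -∑ l, (leviCivita g x l k j * A x l i + leviCivita g x l k i * A x j l) := by
      rw [← Finset.sum_neg_distrib]
      refine Finset.sum_congr rfl fun l _ => ?_
      rw [ha x l j, ha x i l]; ring
    rw [h]
    ring
  have hD1 : ∀ m k i j, nablaThree (leviCivita g) T y m k i j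
      = -nablaThree (leviCivita g) T y m i k j := by
    intro m k i j
    unfold nablaThree
    rw [pd_congr (h := fun x => -T x i k j) m (Filter.eventuallyEq_of_mem (hU.mem_nhds hy)
      fun x hx => hT12 x hx k i j), pd_neg, neg_sub, sub_eq_add_neg, add_comm,
      ← Finset.sum_neg_distrib, ← sub_eq_add_neg]
    congr 1
    refine Finset.sum_congr rfl fun l _ => ?_
    rw [hT12 y hy l i j, hT12 y hy k l j, hT12 y hy k i l]
    ring
  have hD23 : ∀ m k i j, nablaThree (leviCivita g) T y m k i j
      = -nablaThree (leviCivita g) T y m k j i := by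
    intro m k i j
    unfold nablaThree
    have e : (fun x => T x k i j) = fun x => -T x k j i := funext fun x => hT23 x k i j
    rw [e, pd_neg, neg_sub, sub_eq_add_neg, add_comm,
      ← Finset.sum_neg_distrib, ← sub_eq_add_neg]
    congr 1
    refine Finset.sum_congr rfl fun l _ => ?_
    rw [hT23 y l i j, hT23 y k l j, hT23 y k i l]
    ring
  have hZ : ∀ j, DifferentiableAt ℝ (fun x => codiff g A x j) y := fun j =>
    (contDiffAt_codiff hgy hdy (hA y hy) j).differentiableAt (by simp)
  have hgc : ∀ i j, DifferentiableAt ℝ (fun x => (g x i j : ℂ)) y := fun i j =>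
    (contDiffAt_ofReal (hgy i j)).differentiableAt (by simp)
  have hn : ∀ k i j, DifferentiableAt ℝ (fun x => nablaTwo (leviCivita g) A x k i j) y :=
    fun k i j => (contDiffAt_covDeriv hgy hdy (hA y hy) k i j).differentiableAt (by simp)
  -- Since `g` is parallel, differentiating the trace part only differentiates `Z`.
  have hX : ∀ m k i j, nablaThree (leviCivita g) (nablaTwo (leviCivita g) A) y m k i j
      = nablaThree (leviCivita g) T y m k i j
        + (1 / 3) * (nablaOne (leviCivita g) (codiff g A) y m i * metricC g y k j
          - nablaOne (leviCivita g) (codiff g A) y m j * metricC g y k i) := by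
    intro m k i j
    have hmet : ∀ m k j, pd m (fun x => (g x k j : ℂ)) y - ∑ l, (leviCivita g y l m k * g y l j
        + leviCivita g y l m j * g y k l) = 0 := nablaTwo_metricC hgy hdy hs
    have hpT : pd m (fun x => T x k i j) y
        = pd m (fun x => nablaTwo (leviCivita g) A x k i j) y
          - (1 / 3) * ((pd m (fun x => codiff g A x i) y * g y k j
              + codiff g A y i * pd m (fun x => (g x k j : ℂ)) y)
            - (pd m (fun x => codiff g A x j) y * g y k i
              + codiff g A y j * pd m (fun x => (g x k i : ℂ)) y)) := by
      have e : (fun x => T x k i j) = fun x => nablaTwo (leviCivita g) A x k i j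
          - (1 / 3) * (codiff g A x i * g x k j - codiff g A x j * g x k i) :=
        funext fun x => hTdef x k i j
      have hd := ((hZ i).fun_mul (hgc k j)).fun_sub ((hZ j).fun_mul (hgc k i))
      rw [e, pd_sub m (hn k i j) ((differentiableAt_const (1 / 3 : ℂ)).fun_mul hd),
        pd_mul m (differentiableAt_const (1 / 3 : ℂ)) hd,
        pd_sub m ((hZ i).fun_mul (hgc k j)) ((hZ j).fun_mul (hgc k i)),
        pd_mul m (hZ i) (hgc k j), pd_mul m (hZ j) (hgc k i)]
      simp [pd]
    have h1 := hmet m k j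
    have h2 := hmet m k i
    unfold nablaThree nablaOne
    rw [hpT]
    simp only [hTdef, metricC, Matrix.map_apply, Fin.sum_univ_four] at h1 h2 ⊢
    linear_combination (1 / 3 : ℂ) * (codiff g A y i * h1 - codiff g A y j * h2)
  have hgi := invMetricC_symm (y := y) hs
  have hinv := metricC_mul_invMetricC (g := g) hdy
  have key := contract_killing_equation (gl := metricC g y) (gi := invMetricC g y)
    (C := curvature (leviCivita g) y) (mul_eq_one_comm.1 hinv) hgi
    (fun i j => by simp only [metricC, Matrix.map_apply, hs y i j])
    (curvature_antisymm _ y) (lowerCurvature_pair_symm hU hy hg hdet hs) (A := A y)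
    (z := nablaOne (leviCivita g) (codiff g A) y) (ha y) hD1 hD23 hX
    (ricci_identity (fun a b c => (contDiffAt_ofReal
        (contDiffAt_christoffel hgy hdy a b c)).differentiableAt (by simp)) (hsym y) (hA y hy)) i j
  rw [lieMetric_codiffVec_eq_nabla hU hy hgy hdet hs (hA y hy), key]
  have hE : ∀ l m, (((ricciEnd g y).map Complex.ofReal) l m : ℂ)
      = ∑ a, invMetricC g y l a * ∑ e, curvature (leviCivita g) y e a e m := fun l m => by
    simp only [ricciEnd, ricci, Matrix.map_apply, Matrix.mul_apply, Matrix.of_apply,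
      Complex.ofReal_sum, Complex.ofReal_mul, ofReal_riemann hgy hdy hs, invMetricC]
  have hRic : ∀ a b, ∑ e, curvature (leviCivita g) y e a e b
      = ∑ e, curvature (leviCivita g) y e b e a :=
    (contract_curvature (mul_eq_one_comm.1 hinv) hgi (curvature_antisymm _ y)
      (lowerCurvature_pair_symm hU hy hg hdet hs)).2.1
  have hE' : ∀ i l, (metricC g y * ((ricciEnd g y).map Complex.ofReal) * invMetricC g y) i l
      = ∑ a, invMetricC g y l a * ∑ e, curvature (leviCivita g) y e a e i := fun i l => by
    have : (ricciEnd g y).map Complex.ofReal = invMetricC g y *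
        Matrix.of fun a b => ∑ e, curvature (leviCivita g) y e a e b := by
      ext l m; rw [hE, Matrix.mul_apply]; rfl
    rw [this, ← Matrix.mul_assoc, hinv, Matrix.one_mul, Matrix.mul_apply]
    refine Finset.sum_congr rfl fun a _ => ?_
    rw [Matrix.of_apply, hRic, hgi, mul_comm]
  have hcomm : metricC g y * ricciCommutator g A y
      = A y * (ricciEnd g y).map Complex.ofReal
        - metricC g y * ((ricciEnd g y).map Complex.ofReal) * invMetricC g y * A y := by
    have : formEnd g A y = invMetricC g y * A y := rfl
    rw [ricciCommutator, this, Matrix.mul_sub]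
    simp only [← Matrix.mul_assoc]
    rw [hinv, Matrix.one_mul]
  rw [hcomm, Matrix.sub_apply, Matrix.mul_apply, Matrix.mul_apply, ← Finset.sum_sub_distrib,
    Finset.mul_sum, Finset.mul_sum]
  refine Finset.sum_congr rfl fun l _ => ?_
  rw [hE, hE', ha y i l]
  ring

theorem ricci_symm {U : Set E4} (hU : IsOpen U) (hy : y ∈ U)
    (hg : ∀ x ∈ U, ∀ i j, ContDiffAt ℝ ∞ (fun x => g x i j) x)
    (hdet : ∀ x ∈ U, (g x).det ≠ 0) (hs : ∀ x i j, g x i j = g x j i) :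
    (ricci g y).IsSymm := by
  have hinv := metricC_mul_invMetricC (g := g) (hdet y hy)
  have hgi : ∀ i j, invMetricC g y i j = invMetricC g y j i := invMetricC_symm hs
  ext a b
  have := (contract_curvature (mul_eq_one_comm.1 hinv) hgi (curvature_antisymm _ y)
      (lowerCurvature_pair_symm hU hy hg hdet hs)).2.1 b a
  simp only [← ofReal_riemann (hg y hy) (hdet y hy) hs] at this
  exact_mod_cast this

end KillingEquation

/-! ### Self-dual endomorphisms of Minkowski space and their commutants. -/

/-- The Minkowski metric. -/
def minkowski : Matrix (Fin 4) (Fin 4) ℝ := Matrix.diagonal ![-1, 1, 1, 1]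

/-- The endomorphism of Minkowski space defined by the self-dual two-form with electric
components `a`, `b`, `c`; here `u = ±i`, the sign depending on the orientation. -/
def selfDualEnd (u a b c : ℂ) : Matrix (Fin 4) (Fin 4) ℂ :=
  !![0, -a, -b, -c; -a, 0, u * c, -(u * b); -b, -(u * c), 0, u * a; -c, u * b, -(u * a), 0]

/-- For fixed `u` the three basis matrices anticommute and square to the identity: a complexified
quaternion algebra. -/
theorem selfDualEnd_sq {u : ℂ} (hu : u ^ 2 = -1) (a b c : ℂ) :
    selfDualEnd u a b c * selfDualEnd u a b c
      = (a ^ 2 + b ^ 2 + c ^ 2) • (1 : Matrix (Fin 4) (Fin 4) ℂ) := by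
  ext i j
  fin_cases i <;> fin_cases j <;>
    simp [selfDualEnd, Matrix.mul_apply, Fin.sum_univ_four] <;> grind

/-- Self-dual and anti-self-dual matrices are the two commuting ideals of the complexified Lorentz
algebra. -/
theorem selfDualEnd_commute {u : ℂ} (hu : u ^ 2 = -1) (a b c a' b' c' : ℂ) :
    selfDualEnd u a b c * selfDualEnd (-u) a' b' c'
      = selfDualEnd (-u) a' b' c' * selfDualEnd u a b c := by
  ext i j
  fin_cases i <;> fin_cases j <;>
    simp [selfDualEnd, Matrix.mul_apply, Fin.sum_univ_four] <;> grind

theorem trace_selfDualEnd_mul {u : ℂ} (hu : u ^ 2 = -1) (a b c a' b' c' : ℂ) :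
    (selfDualEnd u a b c * selfDualEnd (-u) a' b' c').trace = 0 := by
  simp [selfDualEnd, Matrix.trace, Fin.sum_univ_four]
  grind

theorem map_conj_selfDualEnd {u : ℂ} (hu : (starRingEnd ℂ) u = -u) (a b c : ℂ) :
    (selfDualEnd u a b c).map (starRingEnd ℂ)
      = selfDualEnd (-u) (starRingEnd ℂ a) (starRingEnd ℂ b) (starRingEnd ℂ c) := by
  ext i j
  fin_cases i <;> fin_cases j <;> simp [selfDualEnd, hu]

/-- A hermitian matrix whose columns are all proportional to `a` is a real multiple of `a a†`. -/
theorem exists_eq_smul_of_columns_parallel {r : Fin 3 → Fin 3 → ℂ} {a : Fin 3 → ℂ}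
    (hr : ∀ j k, (starRingEnd ℂ) (r j k) = r k j)
    (hp : ∀ j l k, r j k * a l = r l k * a j) (ha : a ≠ 0) :
    ∃ β : ℝ, ∀ j k, r j k = β * (a j * (starRingEnd ℂ) (a k)) := by
  obtain ⟨n, hn, hn'⟩ : ∃ n : ℝ, n ≠ 0 ∧ (n : ℂ) = ∑ l, a l * (starRingEnd ℂ) (a l) := by
    refine ⟨∑ l, Complex.normSq (a l), fun h => ha ?_, ?_⟩
    · rw [Finset.sum_eq_zero_iff_of_nonneg fun i _ => Complex.normSq_nonneg _] at h
      exact funext fun i => Complex.normSq_eq_zero.1 (h i (Finset.mem_univ i))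
    · push_cast
      exact Finset.sum_congr rfl fun l _ => by rw [Complex.mul_conj]
  obtain ⟨t, ht⟩ : ∃ t : ℝ, (t : ℂ) = ∑ l, r l l := by
    refine ⟨(∑ l, r l l).re, Complex.conj_eq_iff_re.1 ?_⟩
    rw [map_sum]
    exact Finset.sum_congr rfl fun l _ => hr l l
  have hn0 : (n : ℂ) ≠ 0 := by exact_mod_cast hn
  refine ⟨t / n, fun j k => ?_⟩
  have h1 : ∑ l, r k l * a l = a k * t := by
    rw [ht, Finset.mul_sum]
    exact Finset.sum_congr rfl fun l _ => by rw [hp k l l, mul_comm]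
  have h2 : ∑ l, r l k * (starRingEnd ℂ) (a l) = (starRingEnd ℂ) (a k) * t := by
    rw [← Complex.conj_ofReal t, ← map_mul, ← h1, map_sum]
    exact Finset.sum_congr rfl fun l _ => by rw [map_mul, hr]
  have h3 : r j k * n = a j * ((starRingEnd ℂ) (a k) * t) := by
    rw [hn', ← h2, Finset.mul_sum, Finset.mul_sum]
    exact Finset.sum_congr rfl fun l _ => by rw [← mul_assoc, hp j l k]; ring
  push_cast
  field_simp
  linear_combination h3

/-- The hypotheses are entries of `[K, R] = 0`, where `w`; `x, y, z`; `q`; `s` are the time-time,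
time-space, spatial diagonal and spatial off-diagonal entries of `R`. Writing `R = α + Σ r_{jk} E_j
Ē_k` and using that `Ē_k` commutes with `K`, the commutator vanishes iff `(a, b, c)` has zero cross
product with each column of `r`. The three groups of equations are these three cross products. -/
theorem columns_parallel_of_commute {u a b c w x y z q₁ q₂ q₃ s₁ s₂ s₃ : ℂ} (hu : u ^ 2 = -1)
    (h00 : a * x + b * y + c * z = 0)
    (h11 : u * (c * s₃ - b * s₂) = a * x) (h22 : u * (a * s₁ - c * s₃) = b * y)
    (h01 : a * q₁ + b * s₃ + c * s₂ = w * a + u * (y * c - z * b))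
    (h02 : a * s₃ + b * q₂ + c * s₁ = w * b + u * (z * a - x * c))
    (h03 : a * s₂ + b * s₁ + c * q₃ = w * c + u * (x * b - y * a))
    (h12 : u * (c * q₂ - b * s₁ - q₁ * c + s₂ * a) = x * b + a * y)
    (h13 : u * (c * s₁ - b * q₃ + q₁ * b - s₃ * a) = x * c + a * z)
    (h23 : u * (a * q₃ - c * s₂ + s₃ * b - q₂ * a) = y * c + b * z) :
    let α := (w + q₁ + q₂ + q₃) / 4
    (((q₁ + w) / 2 - α) * b = (s₃ - u * z) / 2 * a ∧
    ((q₁ + w) / 2 - α) * c = (s₂ + u * y) / 2 * a ∧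
    (s₃ - u * z) / 2 * c = (s₂ + u * y) / 2 * b) ∧
    ((s₃ + u * z) / 2 * b = ((q₂ + w) / 2 - α) * a ∧
    (s₃ + u * z) / 2 * c = (s₁ - u * x) / 2 * a ∧
    ((q₂ + w) / 2 - α) * c = (s₁ - u * x) / 2 * b) ∧
    ((s₂ - u * y) / 2 * b = (s₁ + u * x) / 2 * a ∧
    (s₂ - u * y) / 2 * c = ((q₃ + w) / 2 - α) * a ∧
    (s₁ + u * x) / 2 * c = ((q₃ + w) / 2 - α) * b) := by
  refine ⟨⟨?_, ?_, ?_⟩, ⟨?_, ?_, ?_⟩, ⟨?_, ?_, ?_⟩⟩ <;> grind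

theorem eq_of_commute_selfDualEnd {u a b c : ℂ} (hu : u ^ 2 = -1) (hu' : (starRingEnd ℂ) u = -u)
    (h0 : ![a, b, c] ≠ 0) {R : Matrix (Fin 4) (Fin 4) ℝ} (hR : (minkowski * R).IsSymm)
    (hc : selfDualEnd u a b c * R.map Complex.ofReal
      = R.map Complex.ofReal * selfDualEnd u a b c) :
    ∃ α β : ℝ, R.map Complex.ofReal = (α : ℂ) • (1 : Matrix (Fin 4) (Fin 4) ℂ)
      + (β : ℂ) • (selfDualEnd u a b c * (selfDualEnd u a b c).map (starRingEnd ℂ)) := by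
  have s1 : R 1 0 = -R 0 1 := by
    have := congrFun (congrFun hR 0) 1; simpa [minkowski] using this
  have s2 : R 2 0 = -R 0 2 := by
    have := congrFun (congrFun hR 0) 2; simpa [minkowski] using this
  have s3 : R 3 0 = -R 0 3 := by
    have := congrFun (congrFun hR 0) 3; simpa [minkowski] using this
  have s4 : R 2 1 = R 1 2 := by
    have := congrFun (congrFun hR 1) 2; simpa [minkowski] using this
  have s5 : R 3 1 = R 1 3 := by
    have := congrFun (congrFun hR 1) 3; simpa [minkowski] using this
  have s6 : R 3 2 = R 2 3 := by
    have := congrFun (congrFun hR 2) 3; simpa [minkowski] using this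
  obtain ⟨T, hT⟩ : ∃ T : Fin 4 → Fin 4 → ℂ, ∀ i j, T i j = R i j := ⟨_, fun _ _ => rfl⟩
  have hTc : ∀ i j, (starRingEnd ℂ) (T i j) = T i j := fun i j => by rw [hT, Complex.conj_ofReal]
  have hS := fun i j => congrFun (congrFun hc i) j
  have c1 : T 1 0 = -T 0 1 := by simp [hT, s1]
  have c2 : T 2 0 = -T 0 2 := by simp [hT, s2]
  have c3 : T 3 0 = -T 0 3 := by simp [hT, s3]
  have c4 : T 2 1 = T 1 2 := by simp [hT, s4]
  have c5 : T 3 1 = T 1 3 := by simp [hT, s5]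
  have c6 : T 3 2 = T 2 3 := by simp [hT, s6]
  simp only [Matrix.mul_apply, Matrix.map_apply, ← hT] at hS
  have h00 := hS 0 0
  have h11 := hS 1 1
  have h22 := hS 2 2
  have h01 := hS 0 1
  have h02 := hS 0 2
  have h03 := hS 0 3
  have h12 := hS 1 2
  have h13 := hS 1 3
  have h23 := hS 2 3
  simp [selfDualEnd, Fin.sum_univ_four, c1, c2, c3, c4, c5, c6] at h00 h11 h22 h01 h02 h03 h12 h13 h23
  clear hS
  -- `α` is a quarter of the trace, and `r` collects the coefficients of `R - α` on the products
  -- `E_j Ē_k`.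
  let α : ℂ := (T 0 0 + T 1 1 + T 2 2 + T 3 3) / 4
  let r : Fin 3 → Fin 3 → ℂ :=
    !![(T 1 1 + T 0 0) / 2 - α, (T 1 2 + u * T 0 3) / 2, (T 1 3 - u * T 0 2) / 2;
      (T 1 2 - u * T 0 3) / 2, (T 2 2 + T 0 0) / 2 - α, (T 2 3 + u * T 0 1) / 2;
      (T 1 3 + u * T 0 2) / 2, (T 2 3 - u * T 0 1) / 2, (T 3 3 + T 0 0) / 2 - α]
  have hr : ∀ j k, (starRingEnd ℂ) (r j k) = r k j := by
    intro j k
    fin_cases j <;> fin_cases k <;> simp [r, α, hTc, hu', map_ofNat] <;> ring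
  have hp : ∀ j l k, r j k * ![a, b, c] l = r l k * ![a, b, c] j := by
    have key := columns_parallel_of_commute (a := a) (b := b) (c := c) (w := T 0 0) (x := T 0 1)
      (y := T 0 2) (z := T 0 3) (q₁ := T 1 1) (q₂ := T 2 2) (q₃ := T 3 3) (s₁ := T 2 3)
      (s₂ := T 1 3) (s₃ := T 1 2) hu (by linear_combination h00 / 2)
      (by linear_combination h11 / 2) (by linear_combination h22 / 2)
      (by linear_combination -h01) (by linear_combination -h02) (by linear_combination -h03)
      (by linear_combination h12) (by linear_combination h13) (by linear_combination h23)
    have q : ∀ k, (r 0 k * b = r 1 k * a) ∧ (r 0 k * c = r 2 k * a) ∧ (r 1 k * c = r 2 k * b) := by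
      intro k
      fin_cases k
      exacts [key.1, key.2.1, key.2.2]
    intro j l k
    fin_cases j <;> fin_cases l <;> simp [q k]
  obtain ⟨β, hβ⟩ := exists_eq_smul_of_columns_parallel hr hp h0
  refine ⟨(R 0 0 + R 1 1 + R 2 2 + R 3 3) / 4, β, ?_⟩
  rw [map_conj_selfDualEnd hu']
  have b00 := hβ 0 0
  have b01 := hβ 0 1
  have b02 := hβ 0 2
  have b10 := hβ 1 0
  have b11 := hβ 1 1
  have b12 := hβ 1 2
  have b20 := hβ 2 0
  have b21 := hβ 2 1
  have b22 := hβ 2 2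
  simp [r, α] at b00 b01 b02 b10 b11 b12 b20 b21 b22
  clear hβ
  ext i j
  have : (((R 0 0 + R 1 1 + R 2 2 + R 3 3) / 4 : ℝ) : ℂ)
    = (T 0 0 + T 1 1 + T 2 2 + T 3 3) / 4 := by simp [hT]
  rw [this]
  clear this hc hR hTc hr hp h00 h11 h22 h01 h02 h03 h12 h13 h23 h0 hu' s1 s2 s3 s4 s5 s6
  clear r α
  fin_cases i <;> fin_cases j <;>
    simp [selfDualEnd, ← hT, c1, c2, c3, c4, c5, c6] <;>
    first
    | linear_combination b00 - b11 - b22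
        - β * (b * (starRingEnd ℂ) b + c * (starRingEnd ℂ) c) * hu
    | linear_combination b11 - b00 - b22
        - β * (a * (starRingEnd ℂ) a + c * (starRingEnd ℂ) c) * hu
    | linear_combination b22 - b00 - b11
        - β * (a * (starRingEnd ℂ) a + b * (starRingEnd ℂ) b) * hu
    | linear_combination b01 + b10 + β * (b * (starRingEnd ℂ) a) * hu
    | linear_combination b01 + b10 + β * (a * (starRingEnd ℂ) b) * hu
    | linear_combination b02 + b20 + β * (c * (starRingEnd ℂ) a) * hu
    | linear_combination b02 + b20 + β * (a * (starRingEnd ℂ) c) * hu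
    | linear_combination b12 + b21 + β * (c * (starRingEnd ℂ) b) * hu
    | linear_combination b12 + b21 + β * (b * (starRingEnd ℂ) c) * hu
    | grind

/-- In Minkowski space a symmetric endomorphism of square zero has rank at most one. -/
theorem rank_one_of_sq_zero {S : Matrix (Fin 4) (Fin 4) ℝ} (hS : (minkowski * S).IsSymm)
    (hsq : S * S = 0) (i j : Fin 4) : S i j * S 0 0 = S i 0 * S 0 j := by
  have horth : Sᵀ * minkowski * S = 0 := by
    have h : Sᵀ * minkowski = minkowski * S := by
      rw [← hS.eq, Matrix.transpose_mul]
      congr 1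
      simp [minkowski]
    rw [h, Matrix.mul_assoc, hsq, Matrix.mul_zero]
  have ho : ∀ i j, -(S 0 i * S 0 j) + S 1 i * S 1 j + S 2 i * S 2 j + S 3 i * S 3 j = 0 := by
    intro i j
    have := congrFun (congrFun horth i) j
    rw [Matrix.mul_assoc] at this
    simpa [minkowski, Matrix.mul_apply, Fin.sum_univ_four] using this
  have h1 := ho 0 0
  have h2 := ho 0 j
  have h3 := ho j j
  -- By `ho` the columns of `S` are null and mutually orthogonal. The combination `S 0 0 • (column
  -- j) - S 0 j • (column 0)` is therefore null, and it has no time component, so its spatial part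
  -- vanishes too.
  have hsum : (S 1 j * S 0 0 - S 1 0 * S 0 j) ^ 2 + (S 2 j * S 0 0 - S 2 0 * S 0 j) ^ 2
      + (S 3 j * S 0 0 - S 3 0 * S 0 j) ^ 2 = 0 := by
    linear_combination S 0 0 ^ 2 * h3 - 2 * S 0 0 * S 0 j * h2 + S 0 j ^ 2 * h1
  fin_cases i
  · exact mul_comm _ _
  all_goals
    simp only [Fin.isValue, Fin.mk_one, Fin.reduceFinMk]
    refine sub_eq_zero.1 (pow_eq_zero_iff two_ne_zero |>.1 ?_)
    nlinarith [sq_nonneg (S 1 j * S 0 0 - S 1 0 * S 0 j), sq_nonneg (S 2 j * S 0 0 - S 2 0 * S 0 j),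
      sq_nonneg (S 3 j * S 0 0 - S 3 0 * S 0 j)]

/-! ### Hodge duality and changes of frame. -/

/-- The dual of a two-form with respect to the Levi-Civita symbol. -/
def starForm (B : Matrix (Fin 4) (Fin 4) ℂ) : Matrix (Fin 4) (Fin 4) ℂ :=
  !![0, B 2 3, -B 1 3, B 1 2; -B 2 3, 0, B 0 3, -B 0 2; B 1 3, -B 0 3, 0, B 0 1;
    -B 1 2, B 0 2, -B 0 1, 0]

/-- Skewness under adjacent swaps makes `η` equal to `η 0 1 2 3` times the Levi-Civita symbol. -/
theorem half_sum_alternating_mul {η : Fin 4 → Fin 4 → Fin 4 → Fin 4 → ℂ}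
    {B : Matrix (Fin 4) (Fin 4) ℂ} (h1 : ∀ i j k l, η i j k l = -η j i k l)
    (h2 : ∀ i j k l, η i j k l = -η i k j l) (h3 : ∀ i j k l, η i j k l = -η i j l k)
    (hB : ∀ i j, B i j = -B j i) :
    (Matrix.of fun i j => (1 / 2) * ∑ k, ∑ l, η i j k l * B k l) = η 0 1 2 3 • starForm B := by
  have z12 : ∀ i k l, η i i k l = 0 := fun i k l => self_eq_neg.1 (h1 i i k l)
  have z23 : ∀ i j l, η i j j l = 0 := fun i j l => self_eq_neg.1 (h2 i j j l)
  have z34 : ∀ i j k, η i j k k = 0 := fun i j k => self_eq_neg.1 (h3 i j k k)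
  have z13 : ∀ i j l, η i j i l = 0 := fun i j l => by rw [h2, z12, neg_zero]
  have z24 : ∀ i j k, η i j k j = 0 := fun i j k => by rw [h3, z23, neg_zero]
  have z14 : ∀ i j k, η i j k i = 0 := fun i j k => by rw [h3, z13, neg_zero]
  have e0213 : η 0 2 1 3 = -η 0 1 2 3 := by
    rw [h2 0 2 1 3]
  have e0132 : η 0 1 3 2 = -η 0 1 2 3 := by
    rw [h3 0 1 3 2]
  have e1203 : η 1 2 0 3 = η 0 1 2 3 := by
    rw [h2 1 2 0 3, h1 1 0 2 3]; ring
  have e0231 : η 0 2 3 1 = η 0 1 2 3 := by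
    rw [h3 0 2 3 1, h2 0 2 1 3]; ring
  have e0312 : η 0 3 1 2 = η 0 1 2 3 := by
    rw [h2 0 3 1 2, h3 0 1 3 2]; ring
  have e1230 : η 1 2 3 0 = -η 0 1 2 3 := by
    rw [h3 1 2 3 0, h2 1 2 0 3, h1 1 0 2 3]; ring
  have e1302 : η 1 3 0 2 = -η 0 1 2 3 := by
    rw [h2 1 3 0 2, h3 1 0 3 2, h1 1 0 2 3]; ring
  have e0321 : η 0 3 2 1 = -η 0 1 2 3 := by
    rw [h2 0 3 2 1, h3 0 2 3 1, h2 0 2 1 3]; ring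
  have e1320 : η 1 3 2 0 = η 0 1 2 3 := by
    rw [h2 1 3 2 0, h3 1 2 3 0, h2 1 2 0 3, h1 1 0 2 3]; ring
  have e2301 : η 2 3 0 1 = η 0 1 2 3 := by
    rw [h2 2 3 0 1, h3 2 0 3 1, h1 2 0 1 3, h2 0 2 1 3]; ring
  have e2310 : η 2 3 1 0 = -η 0 1 2 3 := by
    rw [h2 2 3 1 0, h3 2 1 3 0, h1 2 1 0 3, h2 1 2 0 3, h1 1 0 2 3]; ring
  have key : ∀ i j, i < j → (1 / 2) * ∑ k, ∑ l, η i j k l * B k l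
      = η 0 1 2 3 * starForm B i j := by
    intro i j hij
    fin_cases i <;> fin_cases j <;> first | (exact absurd hij (by decide)) | skip
    all_goals
      simp [Fin.sum_univ_four, starForm, z23, z34, z13, z24, z14, e0213, e0132, e1203, e0231, e0312,
        e1230, e1302, e0321, e1320, e2301, e2310, hB 1 0, hB 2 0, hB 3 0, hB 2 1, hB 3 1, hB 3 2]
      try ring
  have hstar : ∀ i j, starForm B i j = -starForm B j i := by
    intro i j
    fin_cases i <;> fin_cases j <;> simp [starForm]
  ext i j
  simp only [Matrix.of_apply, Matrix.smul_apply, smul_eq_mul]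
  rcases lt_trichotomy i j with h | rfl | h
  · exact key i j h
  · have : starForm B i i = 0 := self_eq_neg.1 (hstar i i)
    simp [z12, this]
  · rw [hstar, mul_neg, ← key j i h, ← mul_neg, ← Finset.sum_neg_distrib]
    congr 1
    refine Finset.sum_congr rfl fun k _ => ?_
    rw [← Finset.sum_neg_distrib]
    exact Finset.sum_congr rfl fun l _ => by rw [h1]; ring

/-- Contracting all four slots of the Levi-Civita symbol with `P` multiplies it by `det P`. -/
theorem starForm_congruence (P B : Matrix (Fin 4) (Fin 4) ℂ) (hB : ∀ i j, B i j = -B j i) :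
    Pᵀ * starForm (P * B * Pᵀ) * P = P.det • starForm B := by
  have hd : ∀ i, B i i = 0 := fun i => self_eq_neg.1 (hB i i)
  ext i j
  rw [Matrix.det_succ_row_zero]
  fin_cases i <;> fin_cases j <;>
    simp [starForm, Matrix.mul_apply, Fin.sum_univ_four, Matrix.det_fin_three,
      Fin.succAbove, hd, hB 1 0, hB 2 0, hB 3 0, hB 2 1, hB 3 1, hB 3 2] <;> ring

theorem map_ofReal_mul (M N : Matrix (Fin 4) (Fin 4) ℝ) :
    (M * N).map Complex.ofReal = M.map Complex.ofReal * N.map Complex.ofReal :=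
  Matrix.map_mul (f := Complex.ofRealHom)

theorem map_ofReal_one :
    (1 : Matrix (Fin 4) (Fin 4) ℝ).map Complex.ofReal = 1 :=
  Matrix.map_one _ Complex.ofReal_zero Complex.ofReal_one

theorem map_ofReal_injective {M N : Matrix (Fin 4) (Fin 4) ℝ}
    (h : M.map Complex.ofReal = N.map Complex.ofReal) : M = N :=
  Matrix.map_injective Complex.ofReal_injective h

theorem minkowski_mul_self : minkowski * minkowski = 1 := by
  rw [minkowski, Matrix.diagonal_mul_diagonal, ← Matrix.diagonal_one]
  congr 1
  ext i
  fin_cases i <;> simp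

theorem minkowski_transpose : minkowskiᵀ = minkowski := Matrix.diagonal_transpose _

theorem det_minkowski : minkowski.det = -1 := by
  simp [minkowski, Matrix.det_diagonal, Fin.prod_univ_four]

theorem map_conj_map_ofReal (M : Matrix (Fin 4) (Fin 4) ℝ) :
    (M.map Complex.ofReal).map (starRingEnd ℂ) = M.map Complex.ofReal := by
  ext i j; simp

theorem map_conj_mul (M N : Matrix (Fin 4) (Fin 4) ℂ) :
    (M * N).map (starRingEnd ℂ) = M.map (starRingEnd ℂ) * N.map (starRingEnd ℂ) :=
  Matrix.map_mul

/-- The inverse of an orthonormal frame. -/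
theorem frame_inverse {G P : Matrix (Fin 4) (Fin 4) ℝ} (hP : Pᵀ * G * P = minkowski) :
    P * (minkowski * Pᵀ * G) = 1 ∧ minkowski * Pᵀ * G * P = 1 ∧ G⁻¹ = P * minkowski * Pᵀ := by
  have h1 : minkowski * Pᵀ * G * P = 1 := by
    rw [Matrix.mul_assoc, Matrix.mul_assoc, ← Matrix.mul_assoc Pᵀ, hP, minkowski_mul_self]
  have h2 : P * (minkowski * Pᵀ * G) = 1 := mul_eq_one_comm.1 h1
  refine ⟨h2, h1, Matrix.inv_eq_left_inv ?_⟩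
  simpa only [Matrix.mul_assoc] using h2

/-! ### Normal form of a self-dual two-form in an orthonormal frame. -/

section Frame

variable {g : E4 → Matrix (Fin 4) (Fin 4) ℝ} {η : E4 → Fin 4 → Fin 4 → Fin 4 → Fin 4 → ℝ}
  {A : E4 → Matrix (Fin 4) (Fin 4) ℂ} {y : E4} {P : Matrix (Fin 4) (Fin 4) ℝ}

theorem raiseBoth_eq (g : E4 → Matrix (Fin 4) (Fin 4) ℝ) (A : E4 → Matrix (Fin 4) (Fin 4) ℂ)
    (y : E4) : Matrix.of (raiseBoth g A y)
      = (g y)⁻¹.map Complex.ofReal * A y * ((g y)⁻¹.map Complex.ofReal)ᵀ := by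
  ext i j
  simp only [raiseBoth, Matrix.of_apply, Matrix.mul_apply, Matrix.transpose_apply, Matrix.map_apply,
    Finset.sum_mul]
  rw [Finset.sum_comm]
  exact Finset.sum_congr rfl fun _ _ => Finset.sum_congr rfl fun _ _ => by ring

/-- In an orthonormal frame a self-dual two-form is given by its electric components. -/
theorem exists_selfDualEnd_frame (hP : Pᵀ * g y * P = minkowski) (ha : ∀ i j, A y i j = -A y j i)
    (h1 : ∀ i j k l, η y i j k l = -η y j i k l) (h2 : ∀ i j k l, η y i j k l = -η y i k j l)
    (h3 : ∀ i j k l, η y i j k l = -η y i j l k) (hvol : η y 0 1 2 3 ^ 2 = -(g y).det)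
    (hsd : ∀ i j, hodge g η A y i j = Complex.I * A y i j) :
    ∃ u a b c : ℂ, u ^ 2 = -1 ∧ (starRingEnd ℂ) u = -u ∧
      formEnd g A y = P.map Complex.ofReal * selfDualEnd u a b c
        * (minkowski * Pᵀ * g y).map Complex.ofReal := by
  obtain ⟨hPQ, hQP, hinv⟩ := frame_inverse hP
  obtain ⟨N, hN⟩ : ∃ N, N = minkowski.map Complex.ofReal := ⟨_, rfl⟩
  obtain ⟨p, hp⟩ : ∃ p, p = P.map Complex.ofReal := ⟨_, rfl⟩
  obtain ⟨q, hq⟩ : ∃ q, q = (minkowski * Pᵀ * g y).map Complex.ofReal := ⟨_, rfl⟩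
  have hpt : (Pᵀ).map Complex.ofReal = pᵀ := by rw [hp, Matrix.transpose_map]
  have hpq : p * q = 1 := by rw [hp, hq, ← map_ofReal_mul, hPQ, map_ofReal_one]
  have hqp : q * p = 1 := mul_eq_one_comm.1 hpq
  have hNN : N * N = 1 := by rw [hN, ← map_ofReal_mul, minkowski_mul_self, map_ofReal_one]
  have hNt : Nᵀ = N := by rw [hN, ← Matrix.transpose_map, minkowski_transpose]
  have hgi : (g y)⁻¹.map Complex.ofReal = p * N * pᵀ := by
    rw [hinv, map_ofReal_mul, map_ofReal_mul, hpt, ← hp, ← hN]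
  obtain ⟨A0, hA0⟩ : ∃ A0, A0 = pᵀ * A y * p := ⟨_, rfl⟩
  have haT : (A y)ᵀ = -A y := by ext i j; exact ha j i
  have hA0T : A0ᵀ = -A0 := by
    rw [hA0, Matrix.transpose_mul, Matrix.transpose_mul, Matrix.transpose_transpose, haT]
    simp [Matrix.mul_assoc]
  have hA0a : ∀ i j, A0 i j = -A0 j i := fun i j => by
    have := congrFun (congrFun hA0T j) i; simpa using this
  have hr : Matrix.of (raiseBoth g A y) = p * (N * A0 * N) * pᵀ := by
    rw [raiseBoth_eq, hgi, hA0]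
    simp only [Matrix.transpose_mul, Matrix.transpose_transpose, hNt, Matrix.mul_assoc]
  have hCT : (N * A0 * N)ᵀ = -(N * A0 * N) := by
    rw [Matrix.transpose_mul, Matrix.transpose_mul, hNt, hA0T]
    simp [Matrix.mul_assoc]
  have hCa : ∀ i j, (N * A0 * N) i j = -(N * A0 * N) j i := fun i j => by
    have := congrFun (congrFun hCT j) i; simpa using this
  have hBa : ∀ i j, (Matrix.of (raiseBoth g A y)) i j = -(Matrix.of (raiseBoth g A y)) j i := by
    have : (Matrix.of (raiseBoth g A y))ᵀ = -(Matrix.of (raiseBoth g A y)) := by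
      rw [hr, Matrix.transpose_mul, Matrix.transpose_mul, Matrix.transpose_transpose, hCT]
      simp [Matrix.mul_assoc]
    intro i j
    have := congrFun (congrFun this j) i
    simpa using this
  have hstar : Complex.I • A y = (η y 0 1 2 3 : ℂ) • starForm (p * (N * A0 * N) * pᵀ) := by
    have := half_sum_alternating_mul (η := fun i j k l => (η y i j k l : ℂ))
      (B := Matrix.of (raiseBoth g A y))
      (fun i j k l => by rw [h1]; push_cast; rfl) (fun i j k l => by rw [h2]; push_cast; rfl)
      (fun i j k l => by rw [h3]; push_cast; rfl) hBa
    rw [← hr, ← this]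
    ext i j
    rw [Matrix.smul_apply, smul_eq_mul, ← hsd]
    rfl
  -- `e` is the value of the volume form on the frame, which is `±1`; the frame need not be
  -- positively oriented.
  obtain ⟨e, he⟩ : ∃ e : ℝ, e = η y 0 1 2 3 * P.det := ⟨_, rfl⟩
  have he2 : e ^ 2 = 1 := by
    have hd := congrArg Matrix.det hP
    rw [Matrix.det_mul, Matrix.det_mul, Matrix.det_transpose, det_minkowski] at hd
    rw [he, mul_pow, hvol]
    linear_combination -hd
  have hpdet : p.det = (P.det : ℂ) := by
    rw [hp]
    exact (Complex.ofRealHom.map_det P).symm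
  have hself : Complex.I • A0 = (e : ℂ) • starForm (N * A0 * N) := by
    have h := starForm_congruence p (N * A0 * N) hCa
    have h' : pᵀ * (Complex.I • A y) * p
      = pᵀ * ((η y 0 1 2 3 : ℂ) • starForm (p * (N * A0 * N) * pᵀ)) * p := by rw [hstar]
    simp only [Matrix.mul_smul, Matrix.smul_mul] at h'
    rw [h, ← hA0, smul_smul, hpdet] at h'
    rw [h', he]
    push_cast
    rfl
  have he2' : (e : ℂ) ^ 2 = 1 := by exact_mod_cast he2
  have hI := Complex.I_sq
  have hs01 := congrFun (congrFun hself 0) 1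
  have hs02 := congrFun (congrFun hself 0) 2
  have hs03 := congrFun (congrFun hself 0) 3
  have hd : ∀ i, A0 i i = 0 := fun i => self_eq_neg.1 (hA0a i i)
  simp [starForm, hN, minkowski, Matrix.mul_apply, Matrix.diagonal_apply]
    at hs01 hs02 hs03
  refine ⟨Complex.I * e, A0 0 1, A0 0 2, A0 0 3, ?_, by simp, ?_⟩
  · linear_combination (e : ℂ) ^ 2 * hI - he2'
  have hA : A y = qᵀ * A0 * q := by
    rw [hA0]
    have hqpT : qᵀ * pᵀ = 1 := by rw [← Matrix.transpose_mul, hpq, Matrix.transpose_one]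
    calc A y = (qᵀ * pᵀ) * A y * (p * q) := by rw [hqpT, hpq, Matrix.one_mul, Matrix.mul_one]
      _ = _ := by simp only [Matrix.mul_assoc]
  have hK : N * A0 = selfDualEnd (Complex.I * e) (A0 0 1) (A0 0 2) (A0 0 3) := by
    -- Self-duality expresses the magnetic components through the electric ones.
    have k23 : A0 2 3 = Complex.I * e * A0 0 1 := by
      linear_combination -(e : ℂ) * hs01 - A0 2 3 * he2'
    have k13 : A0 1 3 = -(Complex.I * e * A0 0 2) := by
      linear_combination (e : ℂ) * hs02 - A0 1 3 * he2'
    have k12 : A0 1 2 = Complex.I * e * A0 0 3 := by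
      linear_combination -(e : ℂ) * hs03 - A0 1 2 * he2'
    ext i j
    fin_cases i <;> fin_cases j <;>
      simp [hN, minkowski, selfDualEnd, Matrix.mul_apply, Matrix.diagonal_apply,
        hd, hA0a 1 0, hA0a 2 0, hA0a 3 0, hA0a 2 1, hA0a 3 1, hA0a 3 2, k12, k13, k23]
  have hpqT : pᵀ * qᵀ = 1 := by rw [← Matrix.transpose_mul, hqp, Matrix.transpose_one]
  rw [← hK, ← hp, ← hq, formEnd, hgi, hA]
  calc p * N * pᵀ * (qᵀ * A0 * q) = p * N * (pᵀ * qᵀ) * A0 * q := by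
        simp only [Matrix.mul_assoc]
    _ = _ := by rw [hpqT, Matrix.mul_one]; simp only [Matrix.mul_assoc]

end Frame

/-! ### Transport to an arbitrary frame, and Segrè types. -/

section Pointwise

variable {G P R : Matrix (Fin 4) (Fin 4) ℝ} {F : Matrix (Fin 4) (Fin 4) ℂ} {u a b c : ℂ}

theorem minkowski_mul_frame_symm (P : Matrix (Fin 4) (Fin 4) ℝ) {S : Matrix (Fin 4) (Fin 4) ℝ}
    (hS : (G * S).IsSymm) : (minkowski * (minkowski * Pᵀ * G * S * P)).IsSymm := by
  have : minkowski * (minkowski * Pᵀ * G * S * P) = Pᵀ * (G * S) * P := by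
    simp only [← Matrix.mul_assoc]
    rw [minkowski_mul_self, Matrix.one_mul]
  rw [this, Matrix.IsSymm, Matrix.transpose_mul, Matrix.transpose_mul, Matrix.transpose_transpose,
    hS.eq]
  simp only [Matrix.mul_assoc]

/-- `eq_of_commute_selfDualEnd` conjugated by the real frame `P`, which commutes with complex
conjugation. -/
theorem eq_of_commute_selfDual (hP : Pᵀ * G * P = minkowski) (hu : u ^ 2 = -1)
    (hu' : (starRingEnd ℂ) u = -u)
    (hF : F = P.map Complex.ofReal * selfDualEnd u a b c
      * (minkowski * Pᵀ * G).map Complex.ofReal)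
    (h0 : F ≠ 0) (hR : (G * R).IsSymm) (hc : F * R.map Complex.ofReal = R.map Complex.ofReal * F) :
    ∃ α β : ℝ, R.map Complex.ofReal = (α : ℂ) • (1 : Matrix (Fin 4) (Fin 4) ℂ)
      + (β : ℂ) • (F * F.map (starRingEnd ℂ)) := by
  obtain ⟨hPQ, hQP, -⟩ := frame_inverse hP
  have hR0 := minkowski_mul_frame_symm P hR
  obtain ⟨Q, hQ⟩ : ∃ Q, Q = minkowski * Pᵀ * G := ⟨_, rfl⟩
  rw [← hQ] at hPQ hQP hF hR0
  have hpq : P.map Complex.ofReal * Q.map Complex.ofReal = 1 := by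
    rw [← map_ofReal_mul, hPQ, map_ofReal_one]
  have hqp := mul_eq_one_comm.1 hpq
  obtain ⟨K, hK⟩ : ∃ K, K = selfDualEnd u a b c := ⟨_, rfl⟩
  rw [← hK] at hF
  have hFbar : F.map (starRingEnd ℂ) = P.map Complex.ofReal * K.map (starRingEnd ℂ)
      * Q.map Complex.ofReal := by
    rw [hF, map_conj_mul, map_conj_mul, map_conj_map_ofReal, map_conj_map_ofReal]
  have hKF : K = Q.map Complex.ofReal * F * P.map Complex.ofReal := by
    rw [hF]
    simp only [← Matrix.mul_assoc]
    rw [hqp, Matrix.one_mul, Matrix.mul_assoc, hqp, Matrix.mul_one]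
  have hcK : K * (Q * R * P).map Complex.ofReal = (Q * R * P).map Complex.ofReal * K := by
    rw [map_ofReal_mul, map_ofReal_mul, hKF]
    calc _ = Q.map Complex.ofReal * F * (P.map Complex.ofReal * Q.map Complex.ofReal)
          * R.map Complex.ofReal * P.map Complex.ofReal := by simp only [Matrix.mul_assoc]
      _ = Q.map Complex.ofReal * (F * R.map Complex.ofReal) * P.map Complex.ofReal := by
          rw [hpq, Matrix.mul_one]; simp only [Matrix.mul_assoc]
      _ = Q.map Complex.ofReal * R.map Complex.ofReal
          * (P.map Complex.ofReal * Q.map Complex.ofReal) * F * P.map Complex.ofReal := by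
          rw [hc, hpq, Matrix.mul_one]; simp only [Matrix.mul_assoc]
      _ = _ := by simp only [Matrix.mul_assoc]
  have habc : ![a, b, c] ≠ 0 := by
    intro h
    have ha := congrFun h 0
    have hb := congrFun h 1
    have hcc := congrFun h 2
    simp at ha hb hcc
    apply h0
    have : K = 0 := by
      rw [hK, ha, hb, hcc]
      ext i j
      fin_cases i <;> fin_cases j <;> simp [selfDualEnd]
    rw [hF, this, Matrix.mul_zero, Matrix.zero_mul]
  rw [hK] at hcK
  obtain ⟨α, β, h⟩ := eq_of_commute_selfDualEnd hu hu' habc hR0 hcK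
  refine ⟨α, β, ?_⟩
  have hRR : R.map Complex.ofReal
      = P.map Complex.ofReal * (Q * R * P).map Complex.ofReal * Q.map Complex.ofReal := by
    rw [← map_ofReal_mul, ← map_ofReal_mul]
    congr 1
    calc R = (P * Q) * R * (P * Q) := by rw [hPQ, Matrix.one_mul, Matrix.mul_one]
      _ = _ := by simp only [Matrix.mul_assoc]
  rw [hRR, h, ← hK, Matrix.mul_add, Matrix.add_mul, Matrix.mul_smul, Matrix.smul_mul, Matrix.mul_one,
    hpq, Matrix.mul_smul, Matrix.smul_mul, hFbar, hF]
  congr 2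
  calc _ = P.map Complex.ofReal * K * 1 * K.map (starRingEnd ℂ) * Q.map Complex.ofReal := by
        simp only [Matrix.mul_one, Matrix.mul_assoc]
    _ = _ := by rw [← hqp]; simp only [Matrix.mul_assoc]

/-- Algebraic properties of the endomorphism defined by a self-dual two-form. -/
theorem selfDual_algebra (hP : Pᵀ * G * P = minkowski) (hu : u ^ 2 = -1)
    (hu' : (starRingEnd ℂ) u = -u)
    (hF : F = P.map Complex.ofReal * selfDualEnd u a b c
      * (minkowski * Pᵀ * G).map Complex.ofReal) :
    F * F = (a ^ 2 + b ^ 2 + c ^ 2) • (1 : Matrix (Fin 4) (Fin 4) ℂ) ∧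
    F * F.map (starRingEnd ℂ) = F.map (starRingEnd ℂ) * F ∧
    (F * F.map (starRingEnd ℂ)).trace = 0 ∧
    ∃ S : Matrix (Fin 4) (Fin 4) ℝ, S.map Complex.ofReal = F * F.map (starRingEnd ℂ) := by
  obtain ⟨hPQ, hQP, -⟩ := frame_inverse hP
  obtain ⟨Q, hQ⟩ : ∃ Q, Q = minkowski * Pᵀ * G := ⟨_, rfl⟩
  rw [← hQ] at hPQ hQP hF
  have hpq : P.map Complex.ofReal * Q.map Complex.ofReal = 1 := by
    rw [← map_ofReal_mul, hPQ, map_ofReal_one]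
  have hqp := mul_eq_one_comm.1 hpq
  have hFbar : F.map (starRingEnd ℂ) = P.map Complex.ofReal
      * selfDualEnd (-u) (starRingEnd ℂ a) (starRingEnd ℂ b) (starRingEnd ℂ c)
      * Q.map Complex.ofReal := by
    rw [hF, map_conj_mul, map_conj_mul, map_conj_map_ofReal, map_conj_map_ofReal,
      map_conj_selfDualEnd hu']
  have hmul : ∀ X Y : Matrix (Fin 4) (Fin 4) ℂ,
      (P.map Complex.ofReal * X * Q.map Complex.ofReal)
        * (P.map Complex.ofReal * Y * Q.map Complex.ofReal)
      = P.map Complex.ofReal * (X * Y) * Q.map Complex.ofReal := fun X Y => by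
    calc _ = P.map Complex.ofReal * X * (Q.map Complex.ofReal * P.map Complex.ofReal) * Y
          * Q.map Complex.ofReal := by simp only [Matrix.mul_assoc]
      _ = _ := by rw [hqp, Matrix.mul_one]; simp only [Matrix.mul_assoc]
  have hcomm : F * F.map (starRingEnd ℂ) = F.map (starRingEnd ℂ) * F := by
    rw [hFbar, hF, hmul, hmul, selfDualEnd_commute hu]
  refine ⟨?_, hcomm, ?_, ?_⟩
  · rw [hF, hmul, selfDualEnd_sq hu, Matrix.mul_smul, Matrix.smul_mul, Matrix.mul_one, hpq]
  · rw [hFbar, hF, hmul, Matrix.trace_mul_comm, ← Matrix.mul_assoc, hqp, Matrix.one_mul,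
      trace_selfDualEnd_mul hu]
  · refine ⟨(F * F.map (starRingEnd ℂ)).map Complex.re, ?_⟩
    ext i j
    have h : (F * F.map (starRingEnd ℂ)).map (starRingEnd ℂ) = F * F.map (starRingEnd ℂ) := by
      rw [map_conj_mul]
      have : (F.map (starRingEnd ℂ)).map (starRingEnd ℂ) = F := by ext; simp
      rw [this, hcomm]
    have hij := congrFun (congrFun h i) j
    rw [Matrix.map_apply] at hij
    simp only [Matrix.map_apply]
    exact Complex.conj_eq_iff_re.1 hij

/-- `(S + m)/(2m)` projects onto the eigenspace, whose dimension is thus the trace `4m/(2m) = 2`. -/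
theorem finrank_eigenspace_of_involution {S : Matrix (Fin 4) (Fin 4) ℝ} {m : ℝ} (hm : m ≠ 0)
    (hS : S * S = m ^ 2 • (1 : Matrix (Fin 4) (Fin 4) ℝ)) (htr : S.trace = 0) {α β : ℝ}
    (hβ : β ≠ 0) :
    Module.finrank ℝ (Module.End.eigenspace (Matrix.toLin'
      (α • (1 : Matrix (Fin 4) (Fin 4) ℝ) + β • S)) (α + β * m)) = 2 := by
  let p : Matrix (Fin 4) (Fin 4) ℝ := (1 / (2 * m)) • (S + m • (1 : Matrix (Fin 4) (Fin 4) ℝ))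
  have hproj : LinearMap.IsProj (Module.End.eigenspace (Matrix.toLin'
      (α • (1 : Matrix (Fin 4) (Fin 4) ℝ) + β • S)) (α + β * m)) (Matrix.toLin' p) := by
    constructor
    · intro x
      rw [Module.End.mem_eigenspace_iff, Matrix.toLin'_apply, Matrix.toLin'_apply,
        Matrix.mulVec_mulVec, ← Matrix.smul_mulVec]
      congr 1
      have : S * (S + m • (1 : Matrix (Fin 4) (Fin 4) ℝ))
          = m • (S + m • (1 : Matrix (Fin 4) (Fin 4) ℝ)) := by
        rw [Matrix.mul_add, hS, Matrix.mul_smul, Matrix.mul_one, smul_add, smul_smul, add_comm, sq]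
      simp only [p]
      rw [Matrix.add_mul, Matrix.smul_mul, Matrix.one_mul, Matrix.smul_mul, Matrix.mul_smul, this]
      module
    · intro x hx
      rw [Module.End.mem_eigenspace_iff, Matrix.toLin'_apply, Matrix.add_mulVec,
        Matrix.smul_mulVec, Matrix.smul_mulVec, Matrix.one_mulVec, add_smul, add_right_inj,
        mul_smul] at hx
      have hx' : S *ᵥ x = m • x := smul_right_injective _ hβ hx
      rw [Matrix.toLin'_apply]
      simp only [p]
      rw [Matrix.smul_mulVec, Matrix.add_mulVec, hx', Matrix.smul_mulVec, Matrix.one_mulVec,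
        ← add_smul, smul_smul]
      have : 1 / (2 * m) * (m + m) = 1 := by field_simp; ring
      rw [this, one_smul]
  have h := hproj.trace
  rw [Matrix.trace_toLin'_eq] at h
  have hp : p.trace = 2 := by
    simp only [p, Matrix.trace_smul, Matrix.trace_add, htr, Matrix.trace_one, smul_eq_mul]
    simp
    field_simp
    norm_num
  rw [hp] at h
  exact_mod_cast h.symm

theorem segreTwoDouble_of_involution {S : Matrix (Fin 4) (Fin 4) ℝ} {m : ℝ} (hm : m ≠ 0)
    (hS : S * S = m ^ 2 • (1 : Matrix (Fin 4) (Fin 4) ℝ)) (htr : S.trace = 0) {α β : ℝ}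
    (hβ : β ≠ 0) : SegreTwoDouble (α • (1 : Matrix (Fin 4) (Fin 4) ℝ) + β • S) := by
  refine ⟨α + β * m, α + β * (-m), fun h => ?_, finrank_eigenspace_of_involution hm hS htr hβ,
    finrank_eigenspace_of_involution (neg_ne_zero.2 hm) (by rw [hS, neg_sq]) htr hβ⟩
  have : β * m = 0 := by linarith
  exact mul_ne_zero hβ hm this

theorem segreTwoOneOne_of_null {l k : Fin 4 → ℝ} (hl : l ≠ 0) (hk : k ≠ 0) (hlk : k ⬝ᵥ l = 0)
    {α σ : ℝ} (hσ : σ ≠ 0) :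
    SegreTwoOneOne (α • (1 : Matrix (Fin 4) (Fin 4) ℝ) + σ • Matrix.vecMulVec l k) := by
  refine ⟨α, ?_, ?_⟩
  · rw [add_sub_cancel_left, sq, Matrix.smul_mul, Matrix.mul_smul, Matrix.vecMulVec_mul_vecMulVec,
      hlk]
    simp
  · have e : Module.End.eigenspace (Matrix.toLin'
        (α • (1 : Matrix (Fin 4) (Fin 4) ℝ) + σ • Matrix.vecMulVec l k)) α
        = LinearMap.ker (Matrix.toLin' (Matrix.vecMulVec l k)) := by
      ext x
      rw [Module.End.mem_eigenspace_iff, LinearMap.mem_ker, Matrix.toLin'_apply,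
        Matrix.toLin'_apply, Matrix.add_mulVec, Matrix.smul_mulVec, Matrix.smul_mulVec,
        Matrix.one_mulVec, add_eq_left, smul_eq_zero_iff_right hσ]
    rw [e]
    have h := LinearMap.finrank_range_add_finrank_ker (Matrix.toLin' (Matrix.vecMulVec l k))
    have hr : Module.finrank ℝ (LinearMap.range (Matrix.toLin' (Matrix.vecMulVec l k))) = 1 := by
      refine le_antisymm (Matrix.rank_vecMulVec_le l k) (Nat.one_le_iff_ne_zero.2 fun h0 => ?_)
      have h1 : Matrix.vecMulVec l k = 0 :=
        Matrix.toLin'.map_eq_zero_iff.1 (LinearMap.range_eq_bot.1 (Submodule.finrank_eq_zero.1 h0))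
      obtain ⟨i, hi⟩ := Function.ne_iff.1 hl
      obtain ⟨j, hj⟩ := Function.ne_iff.1 hk
      exact mul_ne_zero hi hj (congrFun (congrFun h1 i) j)
    rw [hr] at h
    simp at h
    omega

end Pointwise

/-! ### Commutation is equivalent to alignment. -/

section Alignment

variable {G P R : Matrix (Fin 4) (Fin 4) ℝ} {F : Matrix (Fin 4) (Fin 4) ℂ} {u a b c : ℂ}

theorem mul_conj_sq (hcomm : F * F.map (starRingEnd ℂ) = F.map (starRingEnd ℂ) * F) {q : ℂ}
    (hq : F * F = q • (1 : Matrix (Fin 4) (Fin 4) ℂ)) {S : Matrix (Fin 4) (Fin 4) ℝ}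
    (hS : S.map Complex.ofReal = F * F.map (starRingEnd ℂ)) :
    S * S = ‖q‖ ^ 2 • (1 : Matrix (Fin 4) (Fin 4) ℝ) := by
  have hq' : F.map (starRingEnd ℂ) * F.map (starRingEnd ℂ)
      = (starRingEnd ℂ) q • (1 : Matrix (Fin 4) (Fin 4) ℂ) := by
    rw [← map_conj_mul, hq]
    ext i j
    by_cases h : i = j <;> simp [h]
  apply map_ofReal_injective
  rw [map_ofReal_mul, hS]
  calc _ = F * (F.map (starRingEnd ℂ) * F) * F.map (starRingEnd ℂ) := by
        simp only [Matrix.mul_assoc]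
    _ = (F * F) * (F.map (starRingEnd ℂ) * F.map (starRingEnd ℂ)) := by
        rw [← hcomm]; simp only [Matrix.mul_assoc]
    _ = _ := by
        rw [hq, hq', Matrix.smul_mul, Matrix.one_mul, smul_smul, Complex.mul_conj,
          Complex.normSq_eq_norm_sq]
        ext i j
        by_cases h : i = j <;> simp [h]

/-- A non-null self-dual two-form commutes with a symmetric tensor iff the latter is aligned. -/
theorem commute_iff_aligned_nonnull (hP : Pᵀ * G * P = minkowski) (hu : u ^ 2 = -1)
    (hu' : (starRingEnd ℂ) u = -u)
    (hF : F = P.map Complex.ofReal * selfDualEnd u a b c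
      * (minkowski * Pᵀ * G).map Complex.ofReal)
    (hR : (G * R).IsSymm) (hq : a ^ 2 + b ^ 2 + c ^ 2 ≠ 0) {r : ℝ} (hr : r ≠ 0) :
    F * R.map Complex.ofReal - R.map Complex.ofReal * F = 0 ↔
      (SegreTwoDouble R ∨ SegreQuadruple R) ∧ ∃ κ Λ : ℝ, R.map Complex.ofReal
        = -(κ : ℂ) • (r : ℂ) • (F * F.map (starRingEnd ℂ))
          + (Λ : ℂ) • (1 : Matrix (Fin 4) (Fin 4) ℂ) := by
  obtain ⟨hsq, hcomm, htr, S, hS⟩ := selfDual_algebra hP hu hu' hF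
  rw [sub_eq_zero]
  constructor
  · intro hc
    have h0 : F ≠ 0 := by
      rintro rfl
      rw [Matrix.zero_mul, eq_comm, smul_eq_zero] at hsq
      exact hsq.elim hq one_ne_zero
    obtain ⟨α, β, h⟩ := eq_of_commute_selfDual hP hu hu' hF h0 hR hc
    refine ⟨?_, -(β / r), α, ?_⟩
    · have hRS : R = α • (1 : Matrix (Fin 4) (Fin 4) ℝ) + β • S := by
        apply map_ofReal_injective
        rw [h, ← hS]
        ext i j
        by_cases hij : i = j <;> simp [hij]
      by_cases hβ : β = 0
      · exact Or.inr ⟨α, by rw [hRS, hβ, zero_smul, add_zero]⟩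
      · left
        rw [hRS]
        refine segreTwoDouble_of_involution (m := ‖a ^ 2 + b ^ 2 + c ^ 2‖) (norm_ne_zero_iff.2 hq)
          (mul_conj_sq hcomm hsq hS) ?_ hβ
        have : ((S.trace : ℝ) : ℂ) = 0 := by
          rw [← htr, ← hS]
          simp [Matrix.trace]
        exact_mod_cast this
    · rw [h, smul_smul, add_comm]
      congr 2
      have : (r : ℂ) ≠ 0 := by exact_mod_cast hr
      push_cast
      field_simp
  -- Conversely, `F` commutes with `F F̄` because it commutes with `F̄`.
  · rintro ⟨-, κ, Λ, h⟩
    rw [h]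
    simp only [Matrix.mul_add, Matrix.add_mul, Matrix.mul_smul, Matrix.smul_mul, Matrix.mul_one,
      Matrix.one_mul]
    congr 3
    rw [Matrix.mul_assoc, hcomm]

/-- For a null self-dual two-form, `A · Ā` is the square of a null vector annihilated by `A`. -/
theorem exists_null_vector (hP : Pᵀ * G * P = minkowski) (hu : u ^ 2 = -1)
    (hu' : (starRingEnd ℂ) u = -u)
    (hF : F = P.map Complex.ofReal * selfDualEnd u a b c
      * (minkowski * Pᵀ * G).map Complex.ofReal)
    (hG : G.IsSymm) (hGF : (G.map Complex.ofReal * F)ᵀ = -(G.map Complex.ofReal * F))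
    (h0 : F ≠ 0) (hq : a ^ 2 + b ^ 2 + c ^ 2 = 0) {S : Matrix (Fin 4) (Fin 4) ℝ}
    (hS : S.map Complex.ofReal = F * F.map (starRingEnd ℂ)) :
    ∃ (l : Fin 4 → ℝ) (s : ℝ), l ≠ 0 ∧ l ⬝ᵥ (G *ᵥ l) = 0 ∧ F *ᵥ (fun i => (l i : ℂ)) = 0 ∧
      G * S = s • Matrix.vecMulVec (G *ᵥ l) (G *ᵥ l) := by
  obtain ⟨hsq, hcomm, -, -⟩ := selfDual_algebra hP hu hu' hF
  obtain ⟨hPQ, hQP, -⟩ := frame_inverse hP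
  rw [hq, zero_smul] at hsq
  have hSS : S * S = 0 := by
    have := mul_conj_sq hcomm (q := 0) (by rw [hsq, zero_smul]) hS
    simpa using this
  have hGS : (G * S).IsSymm := by
    apply map_ofReal_injective
    have hGt : (G.map Complex.ofReal)ᵀ = G.map Complex.ofReal := by
      rw [← Matrix.transpose_map, hG.eq]
    have hbar : (G.map Complex.ofReal * F.map (starRingEnd ℂ))ᵀ
        = -(G.map Complex.ofReal * F.map (starRingEnd ℂ)) := by
      have e : G.map Complex.ofReal * F.map (starRingEnd ℂ)
          = (G.map Complex.ofReal * F).map (starRingEnd ℂ) := by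
        rw [map_conj_mul, map_conj_map_ofReal]
      rw [e, ← Matrix.transpose_map, hGF]
      ext i j
      rw [Matrix.map_apply, Matrix.neg_apply, Matrix.neg_apply, map_neg, Matrix.map_apply]
    rw [Matrix.transpose_mul, hGt] at hbar
    rw [Matrix.transpose_map, map_ofReal_mul, hS, ← Matrix.mul_assoc, Matrix.transpose_mul, hGF,
      Matrix.mul_neg, ← Matrix.mul_assoc, hbar, Matrix.neg_mul, neg_neg, Matrix.mul_assoc, ← hcomm,
      Matrix.mul_assoc]
  have hN := minkowski_mul_frame_symm P hGS
  obtain ⟨Q, hQ⟩ : ∃ Q, Q = minkowski * Pᵀ * G := ⟨_, rfl⟩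
  rw [← hQ] at hPQ hQP hF hN
  obtain ⟨T, hT⟩ : ∃ T, T = Q * S * P := ⟨_, rfl⟩
  rw [← hT] at hN
  have hTT : T * T = 0 := by
    rw [hT]
    calc _ = Q * S * (P * Q) * S * P := by simp only [Matrix.mul_assoc]
      _ = Q * (S * S) * P := by rw [hPQ, Matrix.mul_one]; simp only [Matrix.mul_assoc]
      _ = 0 := by rw [hSS, Matrix.mul_zero, Matrix.zero_mul]
  have hrank := rank_one_of_sq_zero hN hTT
  have hPT : P * T = S * P := by
    rw [hT, ← Matrix.mul_assoc, ← Matrix.mul_assoc, hPQ, Matrix.one_mul]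
  -- `T 0 0 = |a|² + |b|² + |c|²`, which vanishes only for `F = 0`.
  have hT00 : T 0 0 ≠ 0 := by
    have hqp : Q.map Complex.ofReal * P.map Complex.ofReal = 1 := by
      rw [← map_ofReal_mul, hQP, map_ofReal_one]
    have hTc : T.map Complex.ofReal
        = selfDualEnd u a b c * (selfDualEnd u a b c).map (starRingEnd ℂ) := by
      rw [hT, map_ofReal_mul, map_ofReal_mul, hS, hF, map_conj_mul, map_conj_mul,
        map_conj_map_ofReal, map_conj_map_ofReal]
      simp only [← Matrix.mul_assoc]
      rw [hqp, Matrix.one_mul, Matrix.mul_assoc (selfDualEnd u a b c), hqp, Matrix.mul_one,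
        Matrix.mul_assoc, hqp, Matrix.mul_one]
    have h00 := congrFun (congrFun hTc 0) 0
    rw [map_conj_selfDualEnd hu'] at h00
    simp [selfDualEnd, Complex.mul_conj] at h00
    intro hz
    rw [hz] at h00
    have hsum : Complex.normSq a + (Complex.normSq b + Complex.normSq c) = 0 := by
      exact_mod_cast h00.symm
    have ha := Complex.normSq_nonneg a
    have hb := Complex.normSq_nonneg b
    have hc := Complex.normSq_nonneg c
    have ha0 : a = 0 := Complex.normSq_eq_zero.1 (by linarith)
    have hb0 : b = 0 := Complex.normSq_eq_zero.1 (by linarith)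
    have hc0 : c = 0 := Complex.normSq_eq_zero.1 (by linarith)
    apply h0
    have : selfDualEnd u a b c = 0 := by
      rw [ha0, hb0, hc0]
      ext i j
      fin_cases i <;> fin_cases j <;> simp [selfDualEnd]
    rw [hF, this, Matrix.mul_zero, Matrix.zero_mul]
  -- The null vector will be the image under `S` of the timelike frame vector `p₀`. It is null and
  -- killed by `F` because `S² = 0` and `F S = F² F̄ = 0`; the factor `-1/T 0 0` comes from the
  -- rank-one identity `hrank`.
  obtain ⟨p₀, hp₀⟩ : ∃ p₀ : Fin 4 → ℝ, p₀ = P *ᵥ Pi.single 0 1 := ⟨_, rfl⟩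
  have hQt : Qᵀ * Pᵀ = 1 := by rw [← Matrix.transpose_mul, hPQ, Matrix.transpose_one]
  have hv : Pᵀ *ᵥ (G *ᵥ (S *ᵥ p₀)) = (minkowski * T) *ᵥ Pi.single 0 1 := by
    rw [hp₀, Matrix.mulVec_mulVec, Matrix.mulVec_mulVec, Matrix.mulVec_mulVec, Matrix.mul_assoc,
      Matrix.mul_assoc, ← hPT, ← hP]
    simp only [Matrix.mul_assoc]
  refine ⟨S *ᵥ p₀, -(T 0 0)⁻¹, ?_, ?_, ?_, ?_⟩
  · intro h
    rw [h, Matrix.mulVec_zero, Matrix.mulVec_zero] at hv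
    have := congrFun hv 0
    simp [minkowski] at this
    exact hT00 this
  · rw [Matrix.mulVec_mulVec, Matrix.dotProduct_mulVec, ← hGS.eq, Matrix.vecMul_transpose,
      Matrix.mulVec_mulVec, Matrix.mul_assoc, hSS, Matrix.mul_zero, Matrix.zero_mulVec,
      zero_dotProduct]
  · have hFS : F * S.map Complex.ofReal = 0 := by
      rw [hS, ← Matrix.mul_assoc, hsq, Matrix.zero_mul]
    have : (fun i => ((S *ᵥ p₀) i : ℂ)) = S.map Complex.ofReal *ᵥ (fun i => (p₀ i : ℂ)) := by
      ext i
      simp [Matrix.mulVec, dotProduct]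
    rw [this, Matrix.mulVec_mulVec, hFS, Matrix.zero_mulVec]
  · have h1 : minkowski * T = -(T 0 0)⁻¹ • Matrix.vecMulVec ((minkowski * T) *ᵥ Pi.single 0 1)
        ((minkowski * T) *ᵥ Pi.single 0 1) := by
      ext i j
      have hj : (minkowski * T) j 0 = -T 0 j := by
        rw [← hN.apply]
        simp [minkowski]
      simp only [Matrix.smul_apply, Matrix.vecMulVec_apply, Matrix.mulVec_single_one,
        Matrix.col_apply, hj, smul_eq_mul]
      have := hrank i j
      simp only [minkowski, Matrix.diagonal_mul]
      field_simp
      linear_combination (![-1, 1, 1, 1] i : ℝ) * this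
    have h2 : G * S = Qᵀ * (minkowski * T) * Q := by
      rw [← hP]
      calc G * S = (Qᵀ * Pᵀ) * G * S * (P * Q) := by
            rw [hQt, hPQ, Matrix.one_mul, Matrix.mul_one]
        _ = Qᵀ * (Pᵀ * G * (S * P)) * Q := by simp only [Matrix.mul_assoc]
        _ = _ := by rw [← hPT]; simp only [Matrix.mul_assoc]
    rw [h2, h1, Matrix.mul_smul, Matrix.smul_mul, Matrix.mul_vecMulVec, Matrix.vecMulVec_mul,
      ← Matrix.mulVec_transpose, ← hv, Matrix.mulVec_mulVec, hQt, Matrix.one_mulVec]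

/-- A null self-dual two-form commutes with a symmetric tensor iff the latter is aligned. -/
theorem commute_iff_aligned_null (hP : Pᵀ * G * P = minkowski) (hu : u ^ 2 = -1)
    (hu' : (starRingEnd ℂ) u = -u)
    (hF : F = P.map Complex.ofReal * selfDualEnd u a b c
      * (minkowski * Pᵀ * G).map Complex.ofReal)
    (hG : G.IsSymm) (hGF : (G.map Complex.ofReal * F)ᵀ = -(G.map Complex.ofReal * F))
    (h0 : F ≠ 0) (hR : (G * R).IsSymm) (hq : a ^ 2 + b ^ 2 + c ^ 2 = 0) :
    F * R.map Complex.ofReal - R.map Complex.ofReal * F = 0 ↔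
      (SegreTwoOneOne R ∨ SegreQuadruple R) ∧ ∃ (l : Fin 4 → ℝ) (σ Λ : ℝ), l ≠ 0 ∧
        l ⬝ᵥ (G *ᵥ l) = 0 ∧ F *ᵥ (fun i => (l i : ℂ)) = 0 ∧
        G * R = σ • Matrix.vecMulVec (G *ᵥ l) (G *ᵥ l) + Λ • G := by
  obtain ⟨-, -, -, S, hS⟩ := selfDual_algebra hP hu hu' hF
  obtain ⟨hPQ, hQP, hinv⟩ := frame_inverse hP
  have hGi : G⁻¹ * G = 1 := by
    rw [hinv]; simpa only [Matrix.mul_assoc] using hPQ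
  have hlow : ∀ l : Fin 4 → ℝ, ∀ σ Λ : ℝ,
      G * R = σ • Matrix.vecMulVec (G *ᵥ l) (G *ᵥ l) + Λ • G →
      R = Λ • (1 : Matrix (Fin 4) (Fin 4) ℝ) + σ • Matrix.vecMulVec l (G *ᵥ l) := by
    intro l σ Λ h
    have := congrArg (fun X => G⁻¹ * X) h
    simp only [← Matrix.mul_assoc, hGi, Matrix.one_mul, Matrix.mul_add, Matrix.mul_smul,
      Matrix.mul_vecMulVec, Matrix.mulVec_mulVec, Matrix.one_mulVec] at this
    rw [this, add_comm]
  rw [sub_eq_zero]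
  constructor
  · intro hc
    obtain ⟨α, β, h⟩ := eq_of_commute_selfDual hP hu hu' hF h0 hR hc
    obtain ⟨l, s, hl, hnull, hFl, hGS⟩ := exists_null_vector hP hu hu' hF hG hGF h0 hq hS
    have hRS : R = α • (1 : Matrix (Fin 4) (Fin 4) ℝ) + β • S := by
      apply map_ofReal_injective
      rw [h, ← hS]
      ext i j
      by_cases hij : i = j <;> simp [hij]
    have hGR : G * R = (β * s) • Matrix.vecMulVec (G *ᵥ l) (G *ᵥ l) + α • G := by
      rw [hRS, Matrix.mul_add, Matrix.mul_smul, Matrix.mul_smul, hGS, Matrix.mul_one, smul_smul,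
        add_comm]
    refine ⟨?_, l, β * s, α, hl, hnull, hFl, hGR⟩
    rw [hlow l _ _ hGR]
    by_cases hσ : β * s = 0
    · exact Or.inr ⟨α, by rw [hσ, zero_smul, add_zero]⟩
    · refine Or.inl (segreTwoOneOne_of_null hl (fun h => hl ?_) ?_ hσ)
      · rw [← Matrix.one_mulVec l, ← hGi, ← Matrix.mulVec_mulVec, h, Matrix.mulVec_zero]
      · rw [dotProduct_comm, hnull]
  · rintro ⟨-, l, σ, Λ, -, -, hFl, h⟩
    obtain ⟨lc, hlc⟩ : ∃ lc : Fin 4 → ℂ, lc = fun i => (l i : ℂ) := ⟨_, rfl⟩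
    have hRc : R.map Complex.ofReal = (Λ : ℂ) • (1 : Matrix (Fin 4) (Fin 4) ℂ)
        + (σ : ℂ) • Matrix.vecMulVec lc (G.map Complex.ofReal *ᵥ lc) := by
      rw [hlow l σ Λ h]
      ext i j
      by_cases hij : i = j <;>
        simp [hij, hlc, Matrix.vecMulVec_apply, Matrix.mulVec, dotProduct]
    have hGt : (G.map Complex.ofReal)ᵀ = G.map Complex.ofReal := by
      rw [← Matrix.transpose_map, hG.eq]
    rw [← hlc] at hFl
    -- `F` is skew-adjoint, so `F l = 0` also gives `l♭ F = 0`; hence both products of `F` with `l ⊗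
    -- l♭` vanish.
    have hlF : (G.map Complex.ofReal *ᵥ lc) ᵥ* F = 0 := by
      rw [← hGt, Matrix.mulVec_transpose, Matrix.vecMul_vecMul, ← Matrix.mulVec_transpose, hGF,
        Matrix.neg_mulVec, ← Matrix.mulVec_mulVec, hFl, Matrix.mulVec_zero, neg_zero]
    rw [hRc]
    simp only [Matrix.mul_add, Matrix.add_mul, Matrix.mul_smul, Matrix.smul_mul, Matrix.mul_one,
      Matrix.one_mul, Matrix.mul_vecMulVec, Matrix.vecMulVec_mul, hFl, hlF]
    simp

end Alignment

/-- `(A, A) = -½ tr F²` and the identity has trace four. Hence `A` is null exactly when `F² = 0`. -/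
theorem formSq_eq {g : E4 → Matrix (Fin 4) (Fin 4) ℝ} {A : E4 → Matrix (Fin 4) (Fin 4) ℂ} {y : E4}
    (hs : ∀ x i j, g x i j = g x j i) (ha : ∀ i j, A y i j = -A y j i) {q : ℂ}
    (hq : formEnd g A y * formEnd g A y = q • (1 : Matrix (Fin 4) (Fin 4) ℂ)) :
    formSq g A y = -2 * q := by
  obtain ⟨K, hK⟩ : ∃ K, K = (g y)⁻¹.map Complex.ofReal := ⟨_, rfl⟩
  have hKt : Kᵀ = K := by
    ext i j
    rw [Matrix.transpose_apply, hK]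
    exact invMetricC_symm hs j i
  have hAt : (A y)ᵀ = -A y := by ext i j; exact ha j i
  have hF : formEnd g A y = K * A y := by rw [hK]; rfl
  have hr : Matrix.of (raiseBoth g A y) = K * A y * K := by
    rw [raiseBoth_eq, ← hK, hKt]
  have h1 : ∑ i, ∑ j, A y i j * raiseBoth g A y i j
      = ((A y) * (Matrix.of (raiseBoth g A y))ᵀ).trace := by
    simp only [Matrix.trace, Matrix.diag_apply, Matrix.mul_apply, Matrix.transpose_apply,
      Matrix.of_apply]
  have h2 : (K * A y * (K * A y)).trace = 4 * q := by
    rw [← hF, hq, Matrix.trace_smul, Matrix.trace_one]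
    simp [mul_comm]
  rw [formSq, h1, hr, Matrix.transpose_mul, Matrix.transpose_mul, hKt, hAt, Matrix.neg_mul,
    Matrix.mul_neg, Matrix.mul_neg, Matrix.trace_neg, Matrix.trace_mul_comm]
  have : K * (A y * K) * A y = K * A y * (K * A y) := by simp only [Matrix.mul_assoc]
  rw [this, h2]
  ring

end CoordCalc

/-! ### From the manifold to chart components. -/

section Charts

theorem formComp_antisymm {M : Type*} [TopologicalSpace M] [ChartedSpace CoordCalc.E4 M]
    (A : ∀ p : M, TangentSpace (𝓡 4) p [⋀^Fin 2]→L[ℝ] ℂ) (φ : OpenPartialHomeomorph M CoordCalc.E4) (y : CoordCalc.E4)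
    (i j : Fin 4) : formComp A φ y i j = -formComp A φ y j i := by
  have h := (A (φ.symm y)).toAlternatingMap.map_swap ![coordVec φ y j, coordVec φ y i]
    (i := 0) (j := 1) (by decide)
  have e : ![coordVec φ y j, coordVec φ y i] ∘ Equiv.swap (0 : Fin 2) 1
      = ![coordVec φ y i, coordVec φ y j] := by
    funext k
    fin_cases k <;> simp
  rw [e] at h
  exact h

variable {M : Type*} [TopologicalSpace M] [ChartedSpace CoordCalc.E4 M] [IsManifold (𝓡 4) ∞ M]
  (S : SpaceTime M) (A : ∀ p : M, TangentSpace (𝓡 4) p [⋀^Fin 2]→L[ℝ] ℂ)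
  {φ : OpenPartialHomeomorph M CoordCalc.E4} {y : CoordCalc.E4}

theorem metricComp_symm (φ : OpenPartialHomeomorph M CoordCalc.E4) (y : CoordCalc.E4)
    (i j : Fin 4) : metricComp S.g φ y i j = metricComp S.g φ y j i := S.symm _ _ _

theorem volComp_swap (φ : OpenPartialHomeomorph M CoordCalc.E4) (y : CoordCalc.E4)
    (i j k l : Fin 4) :
    volComp S.η φ y i j k l = -volComp S.η φ y j i k l ∧
    volComp S.η φ y i j k l = -volComp S.η φ y i k j l ∧
    volComp S.η φ y i j k l = -volComp S.η φ y i j l k := by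
  have h : ∀ {m n : Fin 4}, m ≠ n → _ := fun {m n} =>
    (S.η (φ.symm y)).toAlternatingMap.map_swap (i := m) (j := n)
      ![coordVec φ y i, coordVec φ y j, coordVec φ y k, coordVec φ y l]
  have e1 : ![coordVec φ y i, coordVec φ y j, coordVec φ y k, coordVec φ y l] ∘
      Equiv.swap (0 : Fin 4) 1
      = ![coordVec φ y j, coordVec φ y i, coordVec φ y k, coordVec φ y l] := by
    funext m
    fin_cases m <;> rfl
  have e2 : ![coordVec φ y i, coordVec φ y j, coordVec φ y k, coordVec φ y l] ∘
      Equiv.swap (1 : Fin 4) 2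
      = ![coordVec φ y i, coordVec φ y k, coordVec φ y j, coordVec φ y l] := by
    funext m
    fin_cases m <;> rfl
  have e3 : ![coordVec φ y i, coordVec φ y j, coordVec φ y k, coordVec φ y l] ∘
      Equiv.swap (2 : Fin 4) 3
      = ![coordVec φ y i, coordVec φ y j, coordVec φ y l, coordVec φ y k] := by
    funext m
    fin_cases m <;> rfl
  have h1 := h (m := 0) (n := 1) (by decide)
  have h2 := h (m := 1) (n := 2) (by decide)
  have h3 := h (m := 2) (n := 3) (by decide)
  rw [e1] at h1
  rw [e2] at h2
  rw [e3] at h3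
  exact ⟨neg_eq_iff_eq_neg.1 h1.symm, neg_eq_iff_eq_neg.1 h2.symm, neg_eq_iff_eq_neg.1 h3.symm⟩

theorem volComp_sq (φ : OpenPartialHomeomorph M CoordCalc.E4) (y : CoordCalc.E4) :
    volComp S.η φ y 0 1 2 3 ^ 2 = -(metricComp S.g φ y).det := by
  have h := S.vol_sq (φ.symm y) ![coordVec φ y 0, coordVec φ y 1, coordVec φ y 2, coordVec φ y 3]
  have e : ∀ i, ![coordVec φ y 0, coordVec φ y 1, coordVec φ y 2, coordVec φ y 3] i
      = coordVec φ y i := by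
    intro i
    fin_cases i <;> rfl
  simp only [e] at h
  exact h

/-- The metric components are brought to Minkowski form by a linear frame. -/
theorem exists_orthonormal_frame (hφ : φ ∈ IsManifold.maximalAtlas (𝓡 4) ∞ M)
    (hy : y ∈ φ.target) :
    ∃ P : Matrix (Fin 4) (Fin 4) ℝ, Pᵀ * metricComp S.g φ y * P = CoordCalc.minkowski := by
  have hd : φ.MDifferentiable (𝓡 4) (𝓡 4) :=
    ⟨(contMDiffOn_of_mem_maximalAtlas hφ).mdifferentiableOn (by simp),
      (contMDiffOn_symm_of_mem_maximalAtlas hφ).mdifferentiableOn (by simp)⟩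
  obtain ⟨L, hL, hsurj⟩ : ∃ L : CoordCalc.E4 →L[ℝ] TangentSpace (𝓡 4) (φ.symm y),
      (∀ i, coordVec φ y i = L (EuclideanSpace.single i 1)) ∧ Function.Surjective L :=
    ⟨mfderiv (𝓡 4) (𝓡 4) φ.symm y, fun _ => rfl, hd.symm.mfderiv_surjective (x := y) hy⟩
  obtain ⟨b, hb⟩ := S.signature (φ.symm y)
  -- The derivative of the inverse chart is onto, so the orthonormal basis has preimages in
  -- coordinate space; these are the columns of the frame matrix.
  choose w hw using fun j => hsurj (b j)
  have hexp : ∀ j, b j = ∑ i, w j i • coordVec φ y i := by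
    intro j
    have h1 : w j = ∑ i, w j i • EuclideanSpace.single i (1 : ℝ) := by
      ext k
      simp [Finset.sum_apply, Pi.single_apply]
    rw [← hw j]
    conv_lhs => rw [h1]
    rw [map_sum]
    refine Finset.sum_congr rfl fun i _ => ?_
    rw [map_smul, hL]
  refine ⟨Matrix.of fun i j => w j i, ?_⟩
  ext j k
  have h := hb j k
  rw [hexp j, hexp k] at h
  simp only [map_sum, map_smul, sum_apply, smul_apply,
    smul_eq_mul] at h
  rw [Matrix.mul_apply]
  simp only [Matrix.mul_apply, Matrix.transpose_apply, Matrix.of_apply, metricComp]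
  have hm : CoordCalc.minkowski j k = if j = k then if j = 0 then -1 else 1 else 0 := by
    rw [CoordCalc.minkowski, Matrix.diagonal_apply]
    fin_cases j <;> simp
  rw [hm, ← h]
  exact Finset.sum_congr rfl fun _ _ => mul_comm _ _

theorem det_metricComp_ne_zero (hφ : φ ∈ IsManifold.maximalAtlas (𝓡 4) ∞ M)
    (hy : y ∈ φ.target) : (metricComp S.g φ y).det ≠ 0 := by
  obtain ⟨P, hP⟩ := exists_orthonormal_frame S hφ hy
  intro h
  have := congrArg Matrix.det hP
  rw [Matrix.det_mul, Matrix.det_mul, h, CoordCalc.det_minkowski] at this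
  norm_num at this

theorem contDiffAt_metricComp (hφ : φ ∈ IsManifold.maximalAtlas (𝓡 4) ∞ M) :
    ∀ x ∈ φ.target, ∀ i j, ContDiffAt ℝ ∞ (fun x => metricComp S.g φ x i j) x :=
  fun _ hx i j => (S.smooth_g φ hφ i j).contDiffAt (φ.open_target.mem_nhds hx)

variable {S A}

theorem lieMetric_divergenceField (hA : IsConformalKillingYano S A)
    (hφ : φ ∈ IsManifold.maximalAtlas (𝓡 4) ∞ M) (hy : y ∈ φ.target) (i j : Fin 4) :
    CoordCalc.lieMetric (metricComp S.g φ) y (divergenceField S A φ) i j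
      = -(3 / 2) * (CoordCalc.metricC (metricComp S.g φ) y
        * CoordCalc.ricciCommutator (metricComp S.g φ) (formComp A φ) y) i j := by
  refine CoordCalc.lieMetric_codiffVec φ.open_target hy (contDiffAt_metricComp S hφ)
    (fun x hx => det_metricComp_ne_zero S hφ hx) (metricComp_symm S φ)
    (fun x hx i j => (hA.smooth φ hφ i j).contDiffAt (φ.open_target.mem_nhds hx))
    (formComp_antisymm A φ) (fun x hx => ?_) i j
  -- The `g`-part of the self-dual metric reproduces the trace part of `∇A`; only the `η`-part
  -- survives, and it is skew in `k`, `i`.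
  have hform : ∀ k i j, CoordCalc.covDeriv (metricComp S.g φ) (formComp A φ) x k i j
      - (1 / 3) * (CoordCalc.codiff (metricComp S.g φ) (formComp A φ) x i * metricComp S.g φ x k j
        - CoordCalc.codiff (metricComp S.g φ) (formComp A φ) x j * metricComp S.g φ x k i)
      = -(Complex.I / 3) * ∑ d, CoordCalc.codiffVec (metricComp S.g φ) (formComp A φ) x d
        * volComp S.η φ x d k i j := by
    intro k i j
    have h := hA.equation φ hφ x hx k i j
    have hl := CoordCalc.lower_codiffVec (g := metricComp S.g φ) (A := formComp A φ)
      (det_metricComp_ne_zero S hφ hx)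
    rw [hl i, hl j]
    simp only [CoordCalc.selfDualMetric, metricComp_symm S φ x _ i,
      metricComp_symm S φ x _ j] at h
    simp only [Fin.sum_univ_four] at h ⊢
    push_cast at h
    rw [metricComp_symm S φ x k i, metricComp_symm S φ x k j]
    linear_combination (1 / 3 : ℂ) * h
  intro k i j
  rw [hform, hform, ← mul_neg, ← Finset.sum_neg_distrib]
  congr 1
  refine Finset.sum_congr rfl fun d _ => ?_
  rw [(volComp_swap S φ x d k i j).2.1]
  push_cast
  ring

theorem ricci_metricComp_symm (S : SpaceTime M) (hφ : φ ∈ IsManifold.maximalAtlas (𝓡 4) ∞ M)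
    (hy : y ∈ φ.target) : (CoordCalc.ricci (metricComp S.g φ) y).IsSymm :=
  CoordCalc.ricci_symm φ.open_target hy (contDiffAt_metricComp S hφ)
    (fun _ hx => det_metricComp_ne_zero S hφ hx) (metricComp_symm S φ)

theorem lower_ricciEnd (S : SpaceTime M) (hφ : φ ∈ IsManifold.maximalAtlas (𝓡 4) ∞ M)
    (hy : y ∈ φ.target) : metricComp S.g φ y * CoordCalc.ricciEnd (metricComp S.g φ) y
      = CoordCalc.ricci (metricComp S.g φ) y := by
  rw [CoordCalc.ricciEnd, ← Matrix.mul_assoc, Matrix.mul_nonsing_inv _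
    (isUnit_iff_ne_zero.2 (det_metricComp_ne_zero S hφ hy)), Matrix.one_mul]

theorem lower_formEnd (S : SpaceTime M) (A : ∀ p : M, TangentSpace (𝓡 4) p [⋀^Fin 2]→L[ℝ] ℂ)
    (hφ : φ ∈ IsManifold.maximalAtlas (𝓡 4) ∞ M) (hy : y ∈ φ.target) :
    (metricComp S.g φ y).map Complex.ofReal
      * CoordCalc.formEnd (metricComp S.g φ) (formComp A φ) y = formComp A φ y := by
  have h : (metricComp S.g φ y).map Complex.ofReal * ((metricComp S.g φ y)⁻¹).map Complex.ofReal
      = 1 := CoordCalc.metricC_mul_invMetricC (det_metricComp_ne_zero S hφ hy)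
  rw [CoordCalc.formEnd, ← Matrix.mul_assoc, h, Matrix.one_mul]

theorem exists_selfDual_frame (hA : IsConformalKillingYano S A)
    (hφ : φ ∈ IsManifold.maximalAtlas (𝓡 4) ∞ M) (hy : y ∈ φ.target) :
    ∃ (P : Matrix (Fin 4) (Fin 4) ℝ) (u a b c : ℂ),
      Pᵀ * metricComp S.g φ y * P = CoordCalc.minkowski ∧ u ^ 2 = -1 ∧ (starRingEnd ℂ) u = -u ∧
      CoordCalc.formEnd (metricComp S.g φ) (formComp A φ) y
        = P.map Complex.ofReal * CoordCalc.selfDualEnd u a b c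
          * (CoordCalc.minkowski * Pᵀ * metricComp S.g φ y).map Complex.ofReal ∧
      CoordCalc.formSq (metricComp S.g φ) (formComp A φ) y = -2 * (a ^ 2 + b ^ 2 + c ^ 2) := by
  obtain ⟨P, hP⟩ := exists_orthonormal_frame S hφ hy
  obtain ⟨u, a, b, c, hu, hu', hF⟩ := CoordCalc.exists_selfDualEnd_frame
    (η := volComp S.η φ) hP (formComp_antisymm A φ y) (fun i j k l => (volComp_swap S φ y i j k l).1)
    (fun i j k l => (volComp_swap S φ y i j k l).2.1)
    (fun i j k l => (volComp_swap S φ y i j k l).2.2) (volComp_sq S φ y) (hA.selfDual φ hφ y hy)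
  refine ⟨P, u, a, b, c, hP, hu, hu', hF, ?_⟩
  have hsq := (CoordCalc.selfDual_algebra hP hu hu' hF).1
  exact CoordCalc.formSq_eq (metricComp_symm S φ) (formComp_antisymm A φ y) hsq

end Charts

end

/-! ### The theorem. -/

theorem theorem1 {M : Type*} [TopologicalSpace M] [ChartedSpace CoordCalc.E4 M]
    [IsManifold (𝓡 4) ∞ M] (S : SpaceTime M)
    (A : ∀ p : M, TangentSpace (𝓡 4) p [⋀^Fin 2]→L[ℝ] ℂ) (hA : IsConformalKillingYano S A) :
    -- `𝒵 = δ𝒜` is Killing (or zero) iff `[𝒜, Ric] = 0`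
    (IsKilling S (divergenceField S A) ↔
      ∀ φ ∈ IsManifold.maximalAtlas (𝓡 4) ∞ M, ∀ y ∈ φ.target,
        CoordCalc.ricciCommutator (metricComp S.g φ) (formComp A φ) y = 0) ∧
    -- where `𝒜` is non-null
    (∀ φ ∈ IsManifold.maximalAtlas (𝓡 4) ∞ M, ∀ y ∈ φ.target,
      CoordCalc.formSq (metricComp S.g φ) (formComp A φ) y ≠ 0 →
      (CoordCalc.ricciCommutator (metricComp S.g φ) (formComp A φ) y = 0 ↔
        (SegreTwoDouble (CoordCalc.ricciEnd (metricComp S.g φ) y) ∨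
          SegreQuadruple (CoordCalc.ricciEnd (metricComp S.g φ) y)) ∧
        ∃ κ Λ : ℝ, (CoordCalc.ricciEnd (metricComp S.g φ) y).map Complex.ofReal
          = -(κ : ℂ) • CoordCalc.structureTensor (metricComp S.g φ) (formComp A φ) y
            + (Λ : ℂ) • (1 : Matrix (Fin 4) (Fin 4) ℂ))) ∧
    -- where `𝒜` is null (and not zero)
    (∀ φ ∈ IsManifold.maximalAtlas (𝓡 4) ∞ M, ∀ y ∈ φ.target,
      formComp A φ y ≠ 0 → CoordCalc.formSq (metricComp S.g φ) (formComp A φ) y = 0 →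
      (CoordCalc.ricciCommutator (metricComp S.g φ) (formComp A φ) y = 0 ↔
        (SegreTwoOneOne (CoordCalc.ricciEnd (metricComp S.g φ) y) ∨
          SegreQuadruple (CoordCalc.ricciEnd (metricComp S.g φ) y)) ∧
        ∃ (l : Fin 4 → ℝ) (σ Λ : ℝ), l ≠ 0 ∧ l ⬝ᵥ (metricComp S.g φ y *ᵥ l) = 0 ∧
          CoordCalc.formEnd (metricComp S.g φ) (formComp A φ) y *ᵥ (fun i => (l i : ℂ)) = 0 ∧
          CoordCalc.ricci (metricComp S.g φ) y
            = σ • Matrix.vecMulVec (metricComp S.g φ y *ᵥ l) (metricComp S.g φ y *ᵥ l)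
              + Λ • metricComp S.g φ y)) := by
  refine ⟨⟨fun h φ hφ y hy => ?_, fun h φ hφ y hy i j => ?_⟩, fun φ hφ y hy hsq => ?_,
    fun φ hφ y hy h0 hsq => ?_⟩
  · have hmat : CoordCalc.metricC (metricComp S.g φ) y
        * CoordCalc.ricciCommutator (metricComp S.g φ) (formComp A φ) y = 0 := by
      ext i j
      have := h φ hφ y hy i j
      rw [lieMetric_divergenceField hA hφ hy] at this
      simpa using this
    have hinv := mul_eq_one_comm.1
      (CoordCalc.metricC_mul_invMetricC (g := metricComp S.g φ) (det_metricComp_ne_zero S hφ hy))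
    rw [← Matrix.one_mul (CoordCalc.ricciCommutator _ _ _), ← hinv, Matrix.mul_assoc, hmat,
      Matrix.mul_zero]
  · rw [lieMetric_divergenceField hA hφ hy, h φ hφ y hy, Matrix.mul_zero, Matrix.zero_apply,
      mul_zero]
  · obtain ⟨P, u, a, b, c, hP, hu, hu', hF, hq⟩ := exists_selfDual_frame hA hφ hy
    have hR : (metricComp S.g φ y * CoordCalc.ricciEnd (metricComp S.g φ) y).IsSymm := by
      rw [lower_ricciEnd S hφ hy]
      exact ricci_metricComp_symm S hφ hy
    -- The factor `r` is here `2/|(A, A)|`, the normalisation of the structure tensor.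
    exact CoordCalc.commute_iff_aligned_nonnull hP hu hu' hF hR
      (fun h => hsq (by rw [hq, h, mul_zero]))
      (div_ne_zero two_ne_zero (norm_ne_zero_iff.2 hsq))
  · obtain ⟨P, u, a, b, c, hP, hu, hu', hF, hq⟩ := exists_selfDual_frame hA hφ hy
    have hR : (metricComp S.g φ y * CoordCalc.ricciEnd (metricComp S.g φ) y).IsSymm := by
      rw [lower_ricciEnd S hφ hy]
      exact ricci_metricComp_symm S hφ hy
    have hlow := lower_formEnd S A hφ hy
    have hT : (formComp A φ y)ᵀ = -formComp A φ y := by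
      ext i j
      exact formComp_antisymm A φ y j i
    rw [← lower_ricciEnd S hφ hy]
    refine CoordCalc.commute_iff_aligned_null hP hu hu' hF ?_ (by rw [hlow, hT]) ?_ hR ?_
    · ext i j
      exact metricComp_symm S φ y j i
    · intro h
      rw [h, Matrix.mul_zero] at hlow
      exact h0 hlow.symm
    · rw [hq] at hsq
      simpa using hsq
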